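/- **Conventions.** Let $K$ be a field. A *curve* over $K$ is a nonsingular (all local rings are regular), projective, geometrically irreducible, one-dimensional variety over $K$, and $K(C)$ is the function field of the curve $C$. A *cover* $\varphi\colon C\to D$ of curves over $K$ is a nonconstant separable $K$-morphism; via $f\mapsto f\circ\varphi$ we regard $K(C)$ as an extension of $K(D)$, and $\deg\varphi=[K(C):K(D)]$. A *decomposition* of $\varphi$ is an expression $\varphi=\varphi_n\circ\varphi_{n-1}\circ\dots\circ\varphi_1$ with $n\ge 1$, where each $\varphi_i\colon C_{i-1}\to C_i$ is a cover of curves over $K$ of degree at least $2$, $C_0=C$ and $C_n=D$. Two decompositions $\varphi=\varphi_n\circ\dots\circ\varphi_1=\psi_m\circ\dots\circ\psi_1$, with $\varphi_i\colon C_{i-1}\to C_i$ and $\psi_i\colon B_{i-1}\to B_i$, are *equivalent* if $m=n$ and there are isomorphisms $\rho_i\colon C_i\to B_i$ over $K$ for $0\le i\le n$ such that $\rho_0$ and $\rho_n$ are the identity maps of $C$ and $D$, and $\psi_i\circ\rho_{i-1}=\rho_i\circ\varphi_i$ for $1\le i\le n$. Fix an algebraic closure $\Omega$ of $K(D)$.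 The *monodromy group* of $\varphi$ is the Galois group of the Galois closure of $K(C)/K(D)$ in $\Omega$, acting by composition on the set of embeddings $K(C)\to\Omega$ which restrict to the identity map on $K(D)$. All chains below are strict and have at least one step. **Lemma 2.1.** Let $K$ be a field and let $\varphi\colon C\to D$ be a cover of curves over $K$. Let $G$ be the monodromy group of $\varphi$, let $H$ be a one-point stabilizer in $G$, and let $A$ be a transitive subgroup of $G$. There are bijections between the following sets: 1. the set of equivalence classes of decompositions of $\varphi$; 2. the set of increasing chains of fields $K(D)=L_0\subsetneq L_1\subsetneq\dots\subsetneq L_n=K(C)$; 3. the set of decreasing chains of groups $G=U_0>U_1>\dots>U_n=H$; 4. the set of decreasing chains of groups $A=J_0>J_1>\dots>J_n=H\cap A$ in which every $J=J_i$ satisfies $JH=HJ$. Moreover, these bijections can be chosen so that, whenever a decomposition $\varphi=\varphi_n\circ\dots\circ\varphi_1$ represents the class corresponding to the chains $(L_i)$, $(U_i)$ and $(J_i)$, these chains all have exactly $n$ steps and $$\deg\varphi_{n-i}=[L_{i+1}:L_i]=[U_i:U_{i+1}]=[J_i:J_{i+1}]\qquad(0\le i<n).$$ -/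

import Mathlib

open CategoryTheory AlgebraicGeometry
open scoped Pointwise

universe u v

/-! ### Curves over a field -/

namespace CurveCovers

attribute [local instance] MvPolynomial.gradedAlgebra

/-- The structure morphism of projective `n`-space `Proj K[X_0, …, X_n]` over `Spec K`. -/
noncomputable def projectiveSpaceToSpec (K : Type u) [Field K] (n : ℕ) :
    Proj (MvPolynomial.homogeneousSubmodule (Fin (n + 1)) K) ⟶ Spec (CommRingCat.of K) :=
  Proj.toSpecZero (MvPolynomial.homogeneousSubmodule (Fin (n + 1)) K) ≫
    Spec.map (CommRingCat.ofHom
      (algebraMap K (MvPolynomial.homogeneousSubmodule (Fin (n + 1)) K 0)))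

/-- A scheme over `Spec K` is projective if it is isomorphic over `K` to a closed subscheme of
some projective space over `K`. -/
def IsProjectiveOver {K : Type u} [Field K] (X : Over (Spec (CommRingCat.of K))) : Prop :=
  ∃ (n : ℕ) (i : X.left ⟶ Proj (MvPolynomial.homogeneousSubmodule (Fin (n + 1)) K)),
    IsClosedImmersion i ∧ i ≫ projectiveSpaceToSpec K n = X.hom

/-- The property of being a curve over `K`: a nonsingular, projective, geometrically irreducible,
one-dimensional variety over `K`. -/
structure IsCurve {K : Type u} [Field K] (X : Over (Spec (CommRingCat.of K))) : Prop where
  isIntegral : IsIntegral X.left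
  projective : IsProjectiveOver X
  geometricallyIrreducible : GeometricallyIrreducible X.hom
  dim_eq_one : topologicalKrullDim X.left = 1
  nonsingular : ∀ x : X.left, IsRegularLocalRing (X.left.presheaf.stalk x)

/-- The category of curves over `K` and morphisms over `K`. -/
abbrev Curve (K : Type u) [Field K] :=
  ObjectProperty.FullSubcategory (C := Over (Spec (CommRingCat.of K))) IsCurve

variable {K : Type u} [Field K]

namespace Curve

/-- The underlying scheme of a curve. -/
noncomputable abbrev scheme (C : Curve K) : Scheme.{u} := C.obj.left

instance (C : Curve K) : IsIntegral C.scheme := C.property.isIntegral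

/-- The function field `K(C)`. -/
noncomputable abbrev functionField (C : Curve K) : Type u := C.scheme.functionField

end Curve

variable {C D : Curve K}

/-- The morphism of schemes underlying a morphism of curves. -/
noncomputable abbrev schemeHom (φ : C ⟶ D) : C.scheme ⟶ D.scheme := φ.hom.left

/-- A morphism of curves is nonconstant if it takes at least two values. -/
def Nonconstant (φ : C ⟶ D) : Prop :=
  ∃ x y : C.scheme, schemeHom φ x ≠ schemeHom φ y

/-- A nonconstant morphism of curves maps the generic point to the generic point. -/
theorem Nonconstant.map_genericPoint {φ : C ⟶ D} (h : Nonconstant φ) :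
    schemeHom φ (genericPoint C.scheme) = genericPoint D.scheme := by
  set z := schemeHom φ (genericPoint C.scheme) with hz
  obtain ⟨c, hc⟩ : ∃ c : C.scheme, schemeHom φ c ≠ z := by
    by_contra! hcon
    obtain ⟨x, y, hxy⟩ := h
    exact hxy ((hcon x).trans (hcon y).symm)
  by_contra hne
  have h1 : z ⤳ schemeHom φ c :=
    ((genericPoint_spec C.scheme).specializes (by trivial)).map (schemeHom φ).continuous
  have h2 : genericPoint D.scheme ⤳ z := (genericPoint_spec D.scheme).specializes (by trivial)
  let I (x : D.scheme) : TopologicalSpace.IrreducibleCloseds D.scheme :=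
    ⟨closure {x}, isIrreducible_singleton.closure, isClosed_closure⟩
  have key {x y : D.scheme} (hs : x ⤳ y) (hn : y ≠ x) : I y < I x := by
    refine lt_of_le_of_ne (specializes_iff_closure_subset.1 hs) fun he => hn ?_
    have he' : closure {y} = closure {x} :=
      congrArg (fun s : TopologicalSpace.IrreducibleCloseds D.scheme =>
        (s : Set D.scheme)) he
    exact ((specializes_iff_closure_subset.2 he'.ge).antisymm
      (specializes_iff_closure_subset.2 he'.le)).eq
  have k1 : I (schemeHom φ c) < I z := key h1 hc
  have k2 : I z < I (genericPoint D.scheme) := key h2 hne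
  let s : LTSeries (TopologicalSpace.IrreducibleCloseds D.scheme) :=
    { length := 2
      toFun := ![I (schemeHom φ c), I z, I (genericPoint D.scheme)]
      step := fun i => by
        fin_cases i
        · exact k1
        · exact k2 }
  have h3 : ((2 : ℕ) : WithBot ℕ∞) ≤ 1 :=
    (Order.LTSeries.length_le_krullDim s).trans D.property.dim_eq_one.le
  exact absurd h3 (by decide)

/-- The homomorphism `K(D) → K(C)`, `f ↦ f ∘ φ`, attached to a nonconstant morphism `φ : C ⟶ D`. -/
noncomputable def functionFieldMap (φ : C ⟶ D) (h : Nonconstant φ) :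
    D.functionField →+* C.functionField :=
  (D.scheme.presheaf.stalkSpecializes (specializes_of_eq h.map_genericPoint) ≫
    (schemeHom φ).stalkMap (genericPoint C.scheme)).hom

/-- A cover: a nonconstant separable morphism of curves. -/
class IsCover (φ : C ⟶ D) : Prop where
  nonconstant : Nonconstant φ
  separable : @Algebra.IsSeparable D.functionField C.functionField _ _
    (functionFieldMap φ nonconstant).toAlgebra

/-- The function field `K(C)` of the source of a cover `φ : C ⟶ D`, regarded as an extension of
`K(D)` through `φ`. -/
def SourceField (φ : C ⟶ D) [IsCover φ] : Type u := C.functionField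

noncomputable instance (φ : C ⟶ D) [IsCover φ] : Field (SourceField φ) :=
  inferInstanceAs (Field C.functionField)

noncomputable instance (φ : C ⟶ D) [IsCover φ] : Algebra D.functionField (SourceField φ) :=
  (functionFieldMap φ IsCover.nonconstant).toAlgebra

/-- The degree `[K(C) : K(D)]` of a cover. -/
noncomputable def degree (φ : C ⟶ D) [IsCover φ] : ℕ :=
  Module.finrank D.functionField (SourceField φ)

/-! ### Decompositions -/

/-- Sequences of `n ≥ 1` covers of degree at least `2`,
`C = C_0 ⟶ C_1 ⟶ ⋯ ⟶ C_n = D`, with fixed ends `C` and `D`. -/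
inductive CoverSeq (D : Curve K) : Curve K → Type (u + 1)
  /-- a single cover `φ₁ : C ⟶ D` -/
  | single {C : Curve K} (φ₁ : C ⟶ D) [IsCover φ₁] (h : 2 ≤ degree φ₁) : CoverSeq D C
  /-- a first cover `φ₁ : C ⟶ C₁` followed by a sequence from `C₁` to `D` -/
  | cons {C C₁ : Curve K} (φ₁ : C ⟶ C₁) [IsCover φ₁] (h : 2 ≤ degree φ₁)
      (d : CoverSeq D C₁) : CoverSeq D C

namespace CoverSeq

/-- The composition `φ_n ∘ ⋯ ∘ φ_1`. -/
noncomputable def comp {D : Curve K} : {C : Curve K} → CoverSeq D C → (C ⟶ D)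
  | _, single φ₁ _ => φ₁
  | _, cons φ₁ _ d => φ₁ ≫ d.comp

/-- The list `[deg φ_1, …, deg φ_n]`. -/
noncomputable def degrees {D : Curve K} : {C : Curve K} → CoverSeq D C → List ℕ
  | _, single φ₁ _ => [degree φ₁]
  | _, cons φ₁ _ d => degree φ₁ :: d.degrees

/-- `EquivOver ρ₀ (φ_1, …, φ_n) (ψ_1, …, ψ_m)`, for an isomorphism `ρ₀ : C_0 ≅ B_0`, says that
`m = n` and that `ρ₀` extends to isomorphisms `ρ_i : C_i ≅ B_i` for `0 ≤ i ≤ n`, with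
`ρ_n` the identity map of `D` and `ψ_i ∘ ρ_{i-1} = ρ_i ∘ φ_i` for `1 ≤ i ≤ n`. -/
inductive EquivOver {D : Curve K} :
    {C B : Curve K} → (C ≅ B) → CoverSeq D C → CoverSeq D B → Prop
  | single {C B : Curve K} (ρ : C ≅ B) (φ₁ : C ⟶ D) (ψ₁ : B ⟶ D) [IsCover φ₁] [IsCover ψ₁]
      (hφ : 2 ≤ degree φ₁) (hψ : 2 ≤ degree ψ₁) (comm : ρ.hom ≫ ψ₁ = φ₁) :
      EquivOver ρ (CoverSeq.single φ₁ hφ) (CoverSeq.single ψ₁ hψ)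
  | cons {C B C₁ B₁ : Curve K} (ρ : C ≅ B) (ρ₁ : C₁ ≅ B₁) (φ₁ : C ⟶ C₁) (ψ₁ : B ⟶ B₁)
      [IsCover φ₁] [IsCover ψ₁] (hφ : 2 ≤ degree φ₁) (hψ : 2 ≤ degree ψ₁)
      (d : CoverSeq D C₁) (e : CoverSeq D B₁) (comm : ρ.hom ≫ ψ₁ = φ₁ ≫ ρ₁.hom)
      (h : EquivOver ρ₁ d e) :
      EquivOver ρ (CoverSeq.cons φ₁ hφ d) (CoverSeq.cons ψ₁ hψ e)

theorem EquivOver.refl {D : Curve K} {C : Curve K} (d : CoverSeq D C) :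
    EquivOver (Iso.refl C) d d := by
  induction d with
  | single φ₁ h => exact .single _ _ _ _ _ (by simp)
  | cons φ₁ h d ih => exact .cons _ (Iso.refl _) _ _ _ _ _ _ (by simp) ih

theorem EquivOver.symm {D : Curve K} {C B : Curve K} {ρ : C ≅ B} {d : CoverSeq D C}
    {e : CoverSeq D B} (h : EquivOver ρ d e) : EquivOver ρ.symm e d := by
  induction h with
  | single ρ φ₁ ψ₁ hφ hψ comm => exact .single _ _ _ _ _ (by simp [← comm])
  | cons ρ ρ₁ φ₁ ψ₁ hφ hψ d e comm h ih =>
    exact .cons _ ρ₁.symm _ _ _ _ _ _ (by simp [Iso.inv_comp_eq, reassoc_of% comm]) ih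

theorem EquivOver.trans {D : Curve K} {C B A : Curve K} {ρ : C ≅ B} {σ : B ≅ A}
    {d : CoverSeq D C} {e : CoverSeq D B} {f : CoverSeq D A}
    (h : EquivOver ρ d e) (h' : EquivOver σ e f) : EquivOver (ρ ≪≫ σ) d f := by
  induction h generalizing A with
  | single ρ φ₁ ψ₁ hφ hψ comm =>
    cases h' with
    | single _ _ χ₁ _ hχ comm' => exact .single _ _ _ _ _ (by simp [comm', comm])
  | cons ρ ρ₁ φ₁ ψ₁ hφ hψ d e comm h ih =>
    cases h' with
    | cons _ σ₁ _ χ₁ _ hχ _ g comm' h' =>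
      exact .cons _ (ρ₁ ≪≫ σ₁) _ _ _ _ _ _ (by simp [comm', reassoc_of% comm]) (ih h')

end CoverSeq

/-- Decompositions of `φ`: expressions `φ = φ_n ∘ ⋯ ∘ φ_1`, `n ≥ 1`, with all `φ_i` covers of
degree at least `2`. -/
def Decomposition (φ : C ⟶ D) : Type (u + 1) := {d : CoverSeq D C // d.comp = φ}

/-- Equivalence of decompositions of `φ`, with `ρ_0` and `ρ_n` the identity maps. -/
instance Decomposition.setoid (φ : C ⟶ D) : Setoid (Decomposition φ) where
  r d e := CoverSeq.EquivOver (Iso.refl C) d.1 e.1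
  iseqv :=
    { refl := fun d => .refl d.1
      symm := fun h => h.symm
      trans := fun h h' => by simpa using h.trans h' }

/-- Equivalence classes of decompositions of `φ`. -/
def DecompositionClass (φ : C ⟶ D) : Type (u + 1) := Quotient (Decomposition.setoid φ)

/-- The equivalence class of a decomposition. -/
def Decomposition.toClass {φ : C ⟶ D} (d : Decomposition φ) : DecompositionClass φ :=
  Quotient.mk _ d

/-! ### The monodromy group -/

section Monodromy

/-- The Galois group of the Galois closure of `L / F` inside `Ω`. -/
abbrev GaloisClosureGroup (F L Ω : Type*) [Field F] [Field L] [Field Ω] [Algebra F L]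
    [Algebra F Ω] : Type _ :=
  Gal(IntermediateField.normalClosure F L Ω/F)

/-- The action of the Galois group of the Galois closure `N` of `L / F` on the `F`-embeddings of
`L` into `Ω`: as such an embedding `f` has image in `N`, one can put `σ • f = σ ∘ f`. -/
noncomputable instance embeddingAction (F L Ω : Type*) [Field F] [Field L] [Field Ω]
    [Algebra F L] [Algebra F Ω] : MulAction (GaloisClosureGroup F L Ω) (L →ₐ[F] Ω) where
  smul σ f := normalClosure.algHomEquiv F L Ω
    ((σ : IntermediateField.normalClosure F L Ω →ₐ[F] IntermediateField.normalClosure F L Ω).comp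
      ((normalClosure.algHomEquiv F L Ω).symm f))
  one_smul f := (normalClosure.algHomEquiv F L Ω).apply_symm_apply f
  mul_smul σ τ f := by
    change normalClosure.algHomEquiv F L Ω _ = normalClosure.algHomEquiv F L Ω _
    refine congrArg _ ?_
    change _ = AlgHom.comp _ ((normalClosure.algHomEquiv F L Ω).symm
      (normalClosure.algHomEquiv F L Ω _))
    rw [Equiv.symm_apply_apply]
    rfl

/-- The embeddings of `K(C)` into `Ω` which restrict to the identity map on `K(D)`. -/
abbrev Embedding (φ : C ⟶ D) [IsCover φ] (Ω : Type v) [Field Ω] [Algebra D.functionField Ω] :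
    Type (max u v) :=
  SourceField φ →ₐ[D.functionField] Ω

/-- The monodromy group of a cover `φ : C ⟶ D`, for an algebraic closure `Ω` of `K(D)`; it acts on
`Embedding φ Ω`. -/
abbrev Mon (φ : C ⟶ D) [IsCover φ] (Ω : Type v) [Field Ω] [Algebra D.functionField Ω] : Type v :=
  GaloisClosureGroup D.functionField (SourceField φ) Ω

end Monodromy

/-! ### Chains -/

/-- Increasing chains `a = c_0 < c_1 < ⋯ < c_n = b` with `n ≥ 1`. -/
structure IncreasingChain {α : Type*} [Preorder α] (a b : α) where
  length : ℕ
  length_pos : 0 < length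
  obj : Fin (length + 1) → α
  strictMono : StrictMono obj
  obj_zero : obj 0 = a
  obj_last : obj (Fin.last length) = b

/-- Decreasing chains `a = c_0 > c_1 > ⋯ > c_n = b` with `n ≥ 1`. -/
structure DecreasingChain {α : Type*} [Preorder α] (a b : α) where
  length : ℕ
  length_pos : 0 < length
  obj : Fin (length + 1) → α
  strictAnti : StrictAnti obj
  obj_zero : obj 0 = a
  obj_last : obj (Fin.last length) = b

/-- The list `[[L_1 : L_0], …, [L_n : L_{n-1}]]` of a chain of intermediate fields. -/
noncomputable def IncreasingChain.fieldDegrees {F L : Type*} [Field F] [Field L] [Algebra F L]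
    {a b : IntermediateField F L} (c : IncreasingChain a b) : List ℕ :=
  List.ofFn fun i : Fin c.length =>
    IntermediateField.relfinrank (c.obj i.castSucc) (c.obj i.succ)

/-- The list `[[U_0 : U_1], …, [U_{n-1} : U_n]]` of a chain of subgroups. -/
noncomputable def DecreasingChain.indices {G : Type*} [Group G] {a b : Subgroup G}
    (c : DecreasingChain a b) : List ℕ :=
  List.ofFn fun i : Fin c.length => (c.obj i.succ).relIndex (c.obj i.castSucc)

/-- Decreasing chains of groups `J` between `A` and `H ∩ A`, all of which satisfy `JH = HJ`. -/
def PermutableChain {G : Type*} [Group G] (A H : Subgroup G) : Type _ :=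
  {c : DecreasingChain A (H ⊓ A) //
    ∀ i, (c.obj i : Set G) * (H : Set G) = (H : Set G) * (c.obj i : Set G)}

end CurveCovers

/-! The four sets are compared through function fields, then through Galois theory, then through the
factorization G = AH.

Geometry to fields. A curve is regular of dimension one, so its local rings are valuation rings.
Curves are also proper, so the valuative criterion extends every K-morphism from the generic point
of C to D (`exists_hom_of_generic`), and separatedness makes the extension unique. Hence nonconstant
morphisms C → D amount to K-embeddings K(D) → K(C). Conversely, a field M between K(D) and K(C) is
the function field of a curve under C: the normalization of D in M is finite over D with principal
stalks (`exists_normalization`), it is dominated by C and therefore geometrically irreducible, and a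
proper integral scheme whose stalks are valuation rings is projective
(`isProjectiveOver_of_isProper`). This is `exists_curve_of_intermediateField`. A decomposition is
thus determined up to equivalence by the chain of images of the K(C_i) in K(C), and every strict
chain occurs.

Fields to groups. The Galois closure is finite Galois over K(D), and the stabilizer H of an
embedding x is the group fixing x(K(C)) pointwise. The Galois correspondence turns fields between
K(D) and K(C) into groups between G and H, and relative degrees into indices.

From G to A. Transitivity of A means AH = G. Then U ↦ U ∩ A and J ↦ JH are mutually inverse between
the groups containing H and the groups between H ∩ A and A that permute with H, and they preserve
indices because A is transitive on G/U.

Degrees are carried along as lists. Covers are listed from C down to D, whereas the chains start at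
K(D) or at the full group, so the list of degrees appears reversed. -/

namespace CurveCovers

/-! ### Extending morphisms from the generic point -/

section Extension

variable {X Y S : Scheme.{u}}

/-- The inclusion of the generic point of an irreducible scheme. -/
noncomputable abbrev genericInclusion (X : Scheme.{u}) [IrreducibleSpace X] :
    Spec X.functionField ⟶ X :=
  X.fromSpecStalk (genericPoint X)

instance isDominant_genericInclusion (X : Scheme.{u}) [IrreducibleSpace X] :
    IsDominant (genericInclusion X) := by
  refine ⟨dense_iff_closure_eq.2 (Set.eq_univ_of_univ_subset ?_)⟩
  rw [← (genericPoint_spec X).def]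
  refine closure_mono (Set.singleton_subset_iff.2 ?_)
  rw [Scheme.range_fromSpecStalk]
  exact specializes_rfl

lemma range_genericInclusion (X : Scheme.{u}) [IsIntegral X] :
    Set.range (genericInclusion X) = {genericPoint X} := by
  rw [Scheme.range_fromSpecStalk]
  ext y
  exact ⟨fun h => (h.antisymm (genericPoint_specializes y)).eq, fun h => by
    rw [Set.mem_singleton_iff.1 h]; exact specializes_rfl⟩

lemma genericInclusion_apply {X : Scheme.{u}} [IsIntegral X] (p) :
    genericInclusion X p = genericPoint X := by
  have : genericInclusion X p ∈ Set.range (genericInclusion X) := ⟨p, rfl⟩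
  rwa [range_genericInclusion] at this

lemma hom_ext_of_generic [IsIntegral X] (sY : Y ⟶ S) [IsSeparated sY] {f g : X ⟶ Y}
    (h : f ≫ sY = g ≫ sY) (hg : genericInclusion X ≫ f = genericInclusion X ≫ g) : f = g :=
  ext_of_isDominant_of_isSeparated sY h (genericInclusion X) hg

/-- A partial map restricted to the generic point through another point of the domain. -/
lemma stalkSpecializes_fromSpecStalkOfMem [IsIntegral X] (f : X.PartialMap Y) {x : X}
    (hx : x ∈ f.domain) :
    Spec.map (X.presheaf.stalkSpecializes (genericPoint_specializes x)) ≫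
      f.fromSpecStalkOfMem hx = f.fromFunctionField := by
  simp only [Scheme.PartialMap.fromFunctionField, Scheme.PartialMap.fromSpecStalkOfMem]
  rw [← Category.assoc]
  congr 1
  rw [← cancel_mono f.domain.ι, Category.assoc, Scheme.Opens.fromSpecStalkOfMem_ι,
    Scheme.Opens.fromSpecStalkOfMem_ι, Scheme.SpecMap_stalkSpecializes_fromSpecStalk]

/-- If the local rings of an integral scheme `X` are valuation rings and `Y` is proper, every
morphism from the generic point of `X` to `Y` extends to `X`. -/
theorem exists_hom_of_generic [IsIntegral X] [S.IsSeparated] [Y.IsSeparated]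
    (sX : X ⟶ S) (sY : Y ⟶ S) [IsProper sY]
    (hX : ∀ x : X, ValuationRing (X.presheaf.stalk x)) (g : Spec X.functionField ⟶ Y)
    (hg : g ≫ sY = genericInclusion X ≫ sX) :
    ∃ f : X ⟶ Y, f ≫ sY = sX ∧ genericInclusion X ≫ f = g := by
  let r := Scheme.RationalMap.ofFunctionField sX sY g hg
  have hr : r.fromFunctionField = g := Scheme.RationalMap.fromFunctionField_ofFunctionField _ _ _ _
  -- The valuative criterion at x lifts `g` to Spec of the local ring at x, and this lift spreads
  -- out to a neighbourhood of x. The resulting partial map agrees with `r` at the generic point, so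
  -- it represents the same rational map and x lies in the domain.
  have hdom : r.domain = ⊤ := by
    refine top_le_iff.1 fun x _ => ?_
    have := hX x
    have hcrit : ValuativeCriterion.Existence sY := by
      have h : (ValuativeCriterion ⊓ @QuasiCompact ⊓ @QuasiSeparated ⊓
          @LocallyOfFiniteType) sY := by
        rw [← IsProper.eq_valuativeCriterion]; infer_instance
      exact h.1.1.1.existence
    have hsq : CommSq g (Spec.map (X.presheaf.stalkSpecializes (genericPoint_specializes x))) sY
        (X.fromSpecStalk x ≫ sX) :=
      ⟨by rw [hg, ← Category.assoc, Scheme.SpecMap_stalkSpecializes_fromSpecStalk]⟩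
    let sq : ValuativeCommSq sY :=
      { R := X.presheaf.stalk x
        commRing := inferInstance
        domain := inferInstanceAs (IsDomain (X.presheaf.stalk x))
        valuationRing := this
        K := X.functionField
        field := inferInstance
        algebra := inferInstanceAs (Algebra (X.presheaf.stalk x) X.functionField)
        isFractionRing := inferInstanceAs (IsFractionRing (X.presheaf.stalk x) X.functionField)
        i₁ := g
        i₂ := X.fromSpecStalk x ≫ sX
        commSq := hsq }
    obtain ⟨l, hl₁, hl₂⟩ : ∃ l : Spec (X.presheaf.stalk x) ⟶ Y,
        Spec.map (X.presheaf.stalkSpecializes (genericPoint_specializes x)) ≫ l = g ∧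
        l ≫ sY = X.fromSpecStalk x ≫ sX := by
      obtain ⟨⟨l, hl₁, hl₂⟩⟩ := (hcrit sq).exists_lift
      exact ⟨l, hl₁, hl₂⟩
    refine Scheme.RationalMap.mem_domain.2 ⟨Scheme.PartialMap.ofFromSpecStalk sX sY l hl₂,
      Scheme.PartialMap.mem_domain_ofFromSpecStalk sX sY l hl₂, ?_⟩
    refine Scheme.RationalMap.eq_of_fromFunctionField_eq _ _ ?_
    rw [hr, Scheme.RationalMap.fromFunctionField_toRationalMap,
      ← stalkSpecializes_fromSpecStalkOfMem _
        (Scheme.PartialMap.mem_domain_ofFromSpecStalk sX sY l hl₂),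
      Scheme.PartialMap.fromSpecStalkOfMem_ofFromSpecStalk, hl₁]
  let q := r.toPartialMap
  have hq : q.domain = ⊤ := hdom
  have hqr : q.fromFunctionField = g := by
    rw [← hr, ← Scheme.RationalMap.fromFunctionField_toRationalMap,
      Scheme.RationalMap.toRationalMap_toPartialMap]
  clear_value q
  obtain ⟨U, hU, q⟩ := q
  dsimp at hq
  subst hq
  have key : genericInclusion X ≫ X.topIso.inv ≫ q = g := by
    rw [← hqr]
    simp only [Scheme.PartialMap.fromFunctionField, Scheme.PartialMap.fromSpecStalkOfMem]
    rw [← Category.assoc]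
    congr 1
    rw [← cancel_mono (Scheme.Opens.ι ⊤), Scheme.Opens.fromSpecStalkOfMem_ι, Category.assoc,
      ← Scheme.topIso_hom, Iso.inv_hom_id, Category.comp_id]
  refine ⟨X.topIso.inv ≫ q, ?_, key⟩
  refine ext_of_isDominant (genericInclusion X) ?_
  rw [← Category.assoc, key, hg]

end Extension

/-! ### Basic properties of curves -/

section CurveBasics

section ProjectiveSpace

attribute [local instance] MvPolynomial.gradedAlgebra

/-- Proj is proper over Spec of the degree-zero part of the graded ring, and the forms of degree
zero are just the constants. -/
instance isProper_projectiveSpaceToSpec (K : Type u) [Field K] (n : ℕ) :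
    IsProper (projectiveSpaceToSpec K n) := by
  have h0 : Function.Bijective
      (algebraMap K (MvPolynomial.homogeneousSubmodule (Fin (n + 1)) K 0)) := by
    refine ⟨fun a b h => MvPolynomial.C_injective _ _ (congrArg Subtype.val h), ?_⟩
    rintro ⟨p, hp⟩
    refine ⟨p.coeff 0, Subtype.ext ?_⟩
    exact (MvPolynomial.totalDegree_eq_zero_iff_eq_C.1
      (Nat.le_zero.1 ((MvPolynomial.mem_homogeneousSubmodule _ _).1 hp).totalDegree_le)).symm
  have : IsIso (CommRingCat.ofHom
      (algebraMap K (MvPolynomial.homogeneousSubmodule (Fin (n + 1)) K 0))) :=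
    (ConcreteCategory.isIso_iff_bijective _).2 h0
  have : IsScalarTower K (MvPolynomial.homogeneousSubmodule (Fin (n + 1)) K 0)
      (MvPolynomial (Fin (n + 1)) K) :=
    ⟨fun a b c => smul_mul_assoc a (b : MvPolynomial (Fin (n + 1)) K) c⟩
  have : Algebra.FiniteType (MvPolynomial.homogeneousSubmodule (Fin (n + 1)) K 0)
      (MvPolynomial (Fin (n + 1)) K) := .of_restrictScalars_finiteType K _ _
  unfold projectiveSpaceToSpec
  infer_instance

end ProjectiveSpace

/-- Regularity turns the bound on the dimension into the same bound on the cotangent space, and a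
Noetherian local domain with cotangent dimension at most one is a field or a discrete valuation
ring. -/
lemma valuationRing_of_isRegularLocalRing (R : Type u) [CommRing R] [IsDomain R]
    [IsRegularLocalRing R] (h : ringKrullDim R ≤ 1) : ValuationRing R := by
  rw [← (IsRegularLocalRing.iff_finrank_cotangentSpace R).1 inferInstance] at h
  exact ((tfae_of_isNoetherianRing_of_isLocalRing_of_isDomain R).out 5 1).1 (by exact_mod_cast h)

lemma ringKrullDim_stalk_le (X : Scheme.{u}) (x : X) :
    ringKrullDim (X.presheaf.stalk x) ≤ topologicalKrullDim X := by
  rw [← PrimeSpectrum.topologicalKrullDim_eq_ringKrullDim]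
  exact (X.fromSpecStalk x).isEmbedding.isInducing.topologicalKrullDim_le

variable {K : Type u} [Field K] {C D E : Curve K}

instance Curve.isProper_hom (C : Curve K) : IsProper C.obj.hom := by
  obtain ⟨n, i, hi, h⟩ := C.property.projective
  rw [← h]
  infer_instance

instance Curve.isSeparated_scheme (C : Curve K) : C.scheme.IsSeparated := by
  constructor
  rw [← Limits.terminal.comp_from C.obj.hom]
  infer_instance

lemma Curve.valuationRing_stalk (C : Curve K) (x : C.scheme) :
    ValuationRing (C.scheme.presheaf.stalk x) := by
  have := C.property.nonsingular x
  exact valuationRing_of_isRegularLocalRing _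
    ((ringKrullDim_stalk_le _ x).trans C.property.dim_eq_one.le)

lemma schemeHom_comp_hom (φ : C ⟶ D) : schemeHom φ ≫ D.obj.hom = C.obj.hom := Over.w φ.hom

lemma schemeHom_comp (φ : C ⟶ D) (ψ : D ⟶ E) : schemeHom (φ ≫ ψ) = schemeHom φ ≫ schemeHom ψ :=
  rfl

lemma schemeHom_injective : Function.Injective (schemeHom : (C ⟶ D) → _) := fun φ ψ h => by
  apply InducedCategory.hom_ext
  exact Over.OverMorphism.ext h

instance isProper_schemeHom (φ : C ⟶ D) : IsProper (schemeHom φ) := by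
  have : IsProper (schemeHom φ ≫ D.obj.hom) := by
    rw [schemeHom_comp_hom]; infer_instance
  exact .of_comp _ D.obj.hom

lemma Curve.exists_ne_genericPoint (C : Curve K) : ∃ x : C.scheme, x ≠ genericPoint C.scheme := by
  by_contra! h
  have : Subsingleton C.scheme := ⟨fun x y => (h x).trans (h y).symm⟩
  have h1 := topologicalKrullDim_zero_of_discreteTopology C.scheme
  rw [C.property.dim_eq_one] at h1
  exact absurd h1 (by decide)

lemma surjective_of_map_genericPoint {X Y : Scheme.{u}} [IsIntegral X] [IsIntegral Y] (f : X ⟶ Y)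
    [IsProper f] (h : f (genericPoint X) = genericPoint Y) : Function.Surjective f := by
  rw [← Set.range_eq_univ, ← Set.univ_subset_iff, ← (genericPoint_spec Y).def]
  refine closure_minimal (Set.singleton_subset_iff.2 ⟨_, h⟩) ?_
  exact f.isClosedMap.isClosed_range

/-- A proper dominant morphism is surjective, and a one-dimensional target has a point other than
the generic one. -/
lemma nonconstant_of_map_genericPoint {φ : C ⟶ D}
    (h : schemeHom φ (genericPoint C.scheme) = genericPoint D.scheme) : Nonconstant φ := by
  obtain ⟨y, hy⟩ := D.exists_ne_genericPoint
  obtain ⟨x, rfl⟩ := surjective_of_map_genericPoint (schemeHom φ) h y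
  exact ⟨x, genericPoint C.scheme, by rwa [h]⟩

lemma Nonconstant.comp {φ : C ⟶ D} {ψ : D ⟶ E} (hφ : Nonconstant φ) (hψ : Nonconstant ψ) :
    Nonconstant (φ ≫ ψ) := by
  apply nonconstant_of_map_genericPoint
  rw [schemeHom_comp, Scheme.Hom.comp_apply, hφ.map_genericPoint, hψ.map_genericPoint]

lemma nonconstant_hom (e : C ≅ D) : Nonconstant e.hom := by
  obtain ⟨y, hy⟩ := C.exists_ne_genericPoint
  refine ⟨y, genericPoint C.scheme, fun h => hy ?_⟩
  have := congrArg (schemeHom e.inv) h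
  rwa [← Scheme.Hom.comp_apply, ← Scheme.Hom.comp_apply, ← schemeHom_comp, e.hom_inv_id] at this

lemma SpecMap_functionFieldMap (φ : C ⟶ D) (h : Nonconstant φ) :
    Spec.map (CommRingCat.ofHom (functionFieldMap φ h)) ≫ genericInclusion D.scheme =
      genericInclusion C.scheme ≫ schemeHom φ := by
  rw [← Scheme.SpecMap_stalkMap_fromSpecStalk, ← Scheme.SpecMap_stalkSpecializes_fromSpecStalk
    (specializes_of_eq h.map_genericPoint), ← Category.assoc, ← Spec.map_comp]
  rfl

/-- `genericInclusion` is a monomorphism, so a map of function fields is recognised by a commutative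
square. Later identities between such maps are checked this way, without computing in stalks. -/
lemma functionFieldMap_eq_iff (φ : C ⟶ D) (h : Nonconstant φ)
    (σ : D.functionField →+* C.functionField) :
    functionFieldMap φ h = σ ↔ Spec.map (CommRingCat.ofHom σ) ≫ genericInclusion D.scheme =
      genericInclusion C.scheme ≫ schemeHom φ := by
  rw [← SpecMap_functionFieldMap φ h, cancel_mono, Spec.map_injective.eq_iff]
  exact ⟨fun h => by rw [h], fun h => congrArg CommRingCat.Hom.hom h.symm⟩

lemma hom_ext_of_functionFieldMap {φ ψ : C ⟶ D} (hφ : Nonconstant φ) (hψ : Nonconstant ψ)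
    (h : functionFieldMap φ hφ = functionFieldMap ψ hψ) : φ = ψ := by
  apply schemeHom_injective
  refine hom_ext_of_generic D.obj.hom (by rw [schemeHom_comp_hom, schemeHom_comp_hom]) ?_
  rw [← SpecMap_functionFieldMap φ hφ, ← SpecMap_functionFieldMap ψ hψ, h]

lemma functionFieldMap_comp {φ : C ⟶ D} {ψ : D ⟶ E} (hφ : Nonconstant φ) (hψ : Nonconstant ψ)
    (h : Nonconstant (φ ≫ ψ)) :
    functionFieldMap (φ ≫ ψ) h = (functionFieldMap φ hφ).comp (functionFieldMap ψ hψ) := by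
  rw [functionFieldMap_eq_iff, CommRingCat.ofHom_comp, Spec.map_comp, Category.assoc,
    SpecMap_functionFieldMap ψ hψ, ← Category.assoc, SpecMap_functionFieldMap φ hφ, schemeHom_comp,
    Category.assoc]

lemma functionFieldMap_id (h : Nonconstant (𝟙 C)) : functionFieldMap (𝟙 C) h = RingHom.id _ := by
  rw [functionFieldMap_eq_iff]
  change Spec.map (𝟙 _) ≫ _ = _ ≫ 𝟙 _
  simp

/-- A homomorphism of function fields is a homomorphism over the base field. -/
def IsOverBase (σ : D.functionField →+* C.functionField) : Prop :=
  Spec.map (CommRingCat.ofHom σ) ≫ genericInclusion D.scheme ≫ D.obj.hom =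
    genericInclusion C.scheme ≫ C.obj.hom

lemma isOverBase_functionFieldMap (φ : C ⟶ D) (h : Nonconstant φ) :
    IsOverBase (functionFieldMap φ h) := by
  rw [IsOverBase, ← Category.assoc, SpecMap_functionFieldMap, Category.assoc, schemeHom_comp_hom]

/-- If `σ` and `σ ∘ τ` are homomorphisms over the base field, so is `τ`. -/
lemma IsOverBase.of_comp {σ : D.functionField →+* C.functionField}
    {τ : E.functionField →+* D.functionField} (hσ : IsOverBase σ) (h : IsOverBase (σ.comp τ)) :
    IsOverBase τ := by
  unfold IsOverBase at *
  rw [CommRingCat.ofHom_comp, Spec.map_comp, Category.assoc, ← hσ] at h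
  -- Morphisms into Spec K are rewritten as ring homomorphisms out of K, where the injective σ can
  -- be cancelled on the left.
  have hinj : Mono (CommRingCat.ofHom σ) := ConcreteCategory.mono_of_injective _ σ.injective
  rw [← Spec.map_preimage (Spec.map (CommRingCat.ofHom τ) ≫ genericInclusion E.scheme ≫ E.obj.hom),
    ← Spec.map_preimage (genericInclusion D.scheme ≫ D.obj.hom), ← Spec.map_comp,
    ← Spec.map_comp] at h
  rw [← Spec.map_preimage (Spec.map (CommRingCat.ofHom τ) ≫ genericInclusion E.scheme ≫ E.obj.hom),
    ← Spec.map_preimage (genericInclusion D.scheme ≫ D.obj.hom)]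
  exact congrArg _ ((cancel_mono _).1 (Spec.map_injective h))

theorem exists_hom_of_functionField (σ : D.functionField →+* C.functionField) (hσ : IsOverBase σ) :
    ∃ (φ : C ⟶ D) (h : Nonconstant φ), functionFieldMap φ h = σ := by
  obtain ⟨f, hf, hf'⟩ := exists_hom_of_generic C.obj.hom D.obj.hom C.valuationRing_stalk
    (Spec.map (CommRingCat.ofHom σ) ≫ genericInclusion D.scheme) (by rw [Category.assoc]; exact hσ)
  let φ : C ⟶ D := InducedCategory.homMk (Over.homMk f hf)
  have hφ : schemeHom φ = f := rfl
  have h : Nonconstant φ := by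
    apply nonconstant_of_map_genericPoint
    obtain ⟨p⟩ : Nonempty (Spec C.scheme.functionField) := inferInstance
    rw [hφ, ← genericInclusion_apply p, ← Scheme.Hom.comp_apply, hf', Scheme.Hom.comp_apply,
      genericInclusion_apply]
  exact ⟨φ, h, (functionFieldMap_eq_iff φ h σ).2 hf'.symm⟩

end CurveBasics

/-! ### The normalization of a regular one-dimensional scheme in a finite separable extension -/

section Normalization

/-- T is an integral closure of S in the fraction field of S itself, so the theorem on integral
closures in finite separable extensions applies to the trivial extension. -/
lemma isDedekindDomain_of_ringEquiv {S T : Type*} [CommRing S] [CommRing T] [IsDedekindDomain S]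
    (e : S ≃+* T) : IsDedekindDomain T := by
  have : IsDomain T := e.symm.toMulEquiv.isDomain _
  let : Algebra S T := e.toRingHom.toAlgebra
  let : Algebra T (FractionRing S) :=
    ((algebraMap S (FractionRing S)).comp e.symm.toRingHom).toAlgebra
  have : IsScalarTower S T (FractionRing S) :=
    .of_algebraMap_eq fun a => congrArg (algebraMap S (FractionRing S)) (e.symm_apply_apply a).symm
  have : IsIntegralClosure T S (FractionRing S) := by
    refine ⟨(IsFractionRing.injective S (FractionRing S)).comp e.symm.injective, fun {x} => ?_⟩
    rw [IsIntegrallyClosed.isIntegral_iff]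
    exact e.surjective.exists.trans (exists_congr fun a => by
      rw [show algebraMap T (FractionRing S) (e a) = algebraMap S (FractionRing S) a from
        congrArg (algebraMap S (FractionRing S)) (e.symm_apply_apply a)]) |>.symm
  exact IsIntegralClosure.isDedekindDomain S (FractionRing S) (FractionRing S) T

/-- The integral closure of a Dedekind domain `A` with fraction field `F` in a copy `R` of a finite
separable extension `L` of `F`. -/
lemma integralClosure_of_ringEquiv {A F L R : Type*} [CommRing A] [IsDedekindDomain A]
    [Field F] [Algebra A F] [IsFractionRing A F] [Field L] [Algebra F L] [FiniteDimensional F L]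
    [Algebra.IsSeparable F L] [CommRing R] [Algebra A R] (θ : R ≃+* L)
    (h : ∀ a, θ (algebraMap A R a) = algebraMap F L (algebraMap A F a)) :
    IsDedekindDomain (integralClosure A R) ∧ Module.Finite A (integralClosure A R) ∧
      ∀ l : L, ∃ x y : integralClosure A R, y ≠ 0 ∧ θ x = l * θ y := by
  let : Algebra A L := ((algebraMap F L).comp (algebraMap A F)).toAlgebra
  have : IsScalarTower A F L := .of_algebraMap_eq' rfl
  let θ' : R ≃ₐ[A] L := { θ with commutes' := h }
  let e : integralClosure A R ≃ₐ[A] integralClosure A L := θ'.mapIntegralClosure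
  have he (x) : ((e x : integralClosure A L) : L) = θ x := rfl
  have h1 : IsDedekindDomain (integralClosure A L) := integralClosure.isDedekindDomain A F L
  have h2 : Module.Finite A (integralClosure A L) := IsIntegralClosure.finite A F L _
  refine ⟨?_, .equiv e.symm.toLinearEquiv, fun l => ?_⟩
  · have : IsDomain (integralClosure A R) := e.toMulEquiv.isDomain _
    exact isDedekindDomain_of_ringEquiv e.toRingEquiv.symm
  · have hA : Algebra.IsAlgebraic A L :=
      (IsFractionRing.comap_isAlgebraic_iff (A := A) (K := F) (C := L)).2 inferInstance
    obtain ⟨a, ha, hl⟩ := (hA.isAlgebraic l).exists_integral_multiple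
    have hne : algebraMap A R a ≠ 0 := fun h0 => ha <| by
      have h1 := h a
      rw [h0, map_zero, eq_comm, map_eq_zero] at h1
      exact (IsFractionRing.injective A F) (h1.trans (map_zero _).symm)
    refine ⟨e.symm ⟨a • l, hl⟩, algebraMap A _ a, fun h0 => hne (congrArg Subtype.val h0), ?_⟩
    rw [← he, AlgEquiv.apply_symm_apply]
    change a • l = l * θ (algebraMap A R a)
    rw [h, Algebra.smul_def, mul_comm]
    rfl

lemma isDedekindDomain_of_isPrincipalIdealRing_localization (A : Type*) [CommRing A] [IsDomain A]
    [IsNoetherianRing A]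
    (h : ∀ (p : Ideal A) [p.IsPrime], IsPrincipalIdealRing (Localization.AtPrime p)) :
    IsDedekindDomain A := by
  have : IsDedekindDomainDvr A :=
    { is_dvr_at_nonzero_prime := fun P hP hP' => by
        have := h P
        exact { not_a_field' := by
                  rw [Ne, ← IsLocalRing.isField_iff_maximalIdeal_eq]
                  exact IsLocalization.AtPrime.not_isField A hP _ } }
  infer_instance

variable {X : Scheme.{u}}

lemma isPrincipalIdealRing_stalk_iff {U : X.Opens} (hU : IsAffineOpen U) (x : X) (hx : x ∈ U) :
    IsPrincipalIdealRing (X.presheaf.stalk x) ↔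
      IsPrincipalIdealRing (Localization.AtPrime (hU.primeIdealOf ⟨x, hx⟩).asIdeal) := by
  let := TopCat.Presheaf.algebra_section_stalk X.presheaf (⟨x, hx⟩ : U)
  have := hU.isLocalization_stalk ⟨x, hx⟩
  let e := IsLocalization.algEquiv (hU.primeIdealOf ⟨x, hx⟩).asIdeal.primeCompl
    (X.presheaf.stalk x) (Localization.AtPrime (hU.primeIdealOf ⟨x, hx⟩).asIdeal)
  exact ⟨fun _ => .of_surjective e.toRingHom e.surjective,
    fun _ => .of_surjective e.symm.toRingHom e.symm.surjective⟩

lemma isPrincipalIdealRing_stalk_of_isDedekindDomain {U : X.Opens} (hU : IsAffineOpen U) {x : X}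
    (hx : x ∈ U) (h : IsDedekindDomain Γ(X, U)) : IsPrincipalIdealRing (X.presheaf.stalk x) := by
  rw [isPrincipalIdealRing_stalk_iff hU x hx]
  exact ((tfae_of_isNoetherianRing_of_isLocalRing_of_isDomain _).out 2 0).1 (by infer_instance)

variable [IsIntegral X]

lemma isDedekindDomain_of_isAffineOpen [IsLocallyNoetherian X]
    (hX : ∀ x : X, IsPrincipalIdealRing (X.presheaf.stalk x)) {U : X.Opens} [hU0 : Nonempty U]
    (hU : IsAffineOpen U) : IsDedekindDomain Γ(X, U) := by
  have : IsNoetherianRing Γ(X, U) := IsLocallyNoetherian.component_noetherian ⟨U, hU⟩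
  refine isDedekindDomain_of_isPrincipalIdealRing_localization _ fun p hp => ?_
  let y : PrimeSpectrum Γ(X, U) := ⟨p, hp⟩
  have hy : hU.fromSpec y ∈ U := by
    have : hU.fromSpec y ∈ Set.range hU.fromSpec := ⟨y, rfl⟩
    rwa [hU.range_fromSpec] at this
  let := TopCat.Presheaf.algebra_section_stalk X.presheaf (⟨hU.fromSpec y, hy⟩ : U)
  have : IsLocalization.AtPrime (X.presheaf.stalk (hU.fromSpec y)) p :=
    hU.isLocalization_stalk' y hy
  have := hX (hU.fromSpec y)
  let e := IsLocalization.algEquiv p.primeCompl (X.presheaf.stalk (hU.fromSpec y))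
    (Localization.AtPrime p)
  exact .of_surjective e.toRingHom e.surjective

/-- A morphism from the spectrum of a field to the generic point factors through the inclusion of
the generic point. -/
lemma exists_eq_SpecMap_comp_genericInclusion (L : Type u) [Field L] (j : Spec (.of L) ⟶ X)
    [IsDominant j] : ∃ τ : X.functionField ⟶ .of L, j = Spec.map τ ≫ genericInclusion X ∧
      ∀ (U : X.Opens) (hU : genericPoint X ∈ U) (hU' : j ⁻¹ᵁ U = ⊤),
        X.presheaf.germ U _ hU ≫ τ =
          j.app U ≫ (Spec (.of L)).presheaf.map (eqToHom hU'.symm).op ≫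
            (Scheme.ΓSpecIso (.of L)).hom := by
  have h : j (IsLocalRing.closedPoint L) = genericPoint X := by
    have : closure {j (IsLocalRing.closedPoint L)} = Set.univ := by
      rw [← j.denseRange.closure_range]
      congr 1
      ext y
      constructor
      · rintro rfl
        exact ⟨_, rfl⟩
      · rintro ⟨z, rfl⟩
        exact congrArg j (Subsingleton.elim z _)
    exact (isGenericPoint_def.2 this).eq (genericPoint_spec X)
  have hs := specializes_of_eq h.symm
  refine ⟨X.presheaf.stalkSpecializes (specializes_of_eq h) ≫ Scheme.stalkClosedPointTo j,
    ?_, fun U hU hU' => ?_⟩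
  · rw [Spec.map_comp, Category.assoc, Scheme.SpecMap_stalkSpecializes_fromSpecStalk,
      Scheme.Spec_stalkClosedPointTo_fromSpecStalk]
  · rw [TopCat.Presheaf.germ_stalkSpecializes_assoc, Scheme.germ_stalkClosedPointTo]
    rfl

/-- Sections over a neighbourhood of the generic point, pulled back to the spectrum of an extension
of the function field. -/
lemma app_comp_eq_germ_comp (L : Type u) [Field L] (σ : X.presheaf.stalk (genericPoint X) ⟶ .of L)
    (U : X.Opens)
    (hU : genericPoint X ∈ U)
    (hU' : (Spec.map σ ≫ genericInclusion X) ⁻¹ᵁ U = ⊤) :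
    (Spec.map σ ≫ genericInclusion X).app U ≫
      (Spec (.of L)).presheaf.map (eqToHom hU'.symm).op ≫ (Scheme.ΓSpecIso (.of L)).hom =
        X.presheaf.germ U _ hU ≫ σ := by
  have : IsLocalHom σ.hom := inferInstanceAs (IsLocalHom (σ.hom : X.functionField →+* L))
  have h2 (p : Spec (.of L)) : (Spec.map σ ≫ genericInclusion X) p ∈ U := by
    rwa [Scheme.Hom.comp_apply, genericInclusion_apply]
  rw [← Scheme.germ_stalkClosedPointTo_Spec_fromSpecStalk σ U (h2 _),
    Scheme.germ_stalkClosedPointTo]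
  rfl

/-- The normalization of a regular one-dimensional scheme in a finite separable extension of its
function field. -/
theorem exists_normalization [X.IsSeparated] [IsLocallyNoetherian X]
    (hX : ∀ x : X, IsPrincipalIdealRing (X.presheaf.stalk x)) (L : Type u) [Field L]
    [Algebra X.functionField L] [FiniteDimensional X.functionField L]
    [Algebra.IsSeparable X.functionField L] :
    ∃ (B : Scheme.{u}) (_ : IsIntegral B) (g : B ⟶ X) (τ : B.functionField ⟶ .of L),
      IsFinite g ∧ (∀ b : B, IsPrincipalIdealRing (B.presheaf.stalk b)) ∧
      Function.Bijective τ ∧ Spec.map τ ≫ genericInclusion B ≫ g =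
        Spec.map (CommRingCat.ofHom (algebraMap X.functionField L)) ≫ genericInclusion X := by
  -- The scheme B is the relative normalization of `f`. Over a nonempty affine U its ring is the
  -- integral closure of Γ(X, U) in the sections over f⁻¹U, and f⁻¹U is all of Spec L, so `θ U`
  -- identifies those sections with L.
  let f : Spec (.of L) ⟶ X :=
    Spec.map (CommRingCat.ofHom (algebraMap X.functionField L)) ≫ genericInclusion X
  have : QuasiSeparated f := by
    have : IsSeparated (f ≫ Limits.terminal.from X) := by
      rw [Limits.terminal.comp_from]; infer_instance
    have : IsSeparated f := .of_comp f (Limits.terminal.from X)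
    infer_instance
  let B := f.normalization
  let g : B ⟶ X := f.fromNormalization
  let j : Spec (.of L) ⟶ B := f.toNormalization
  have hjg : j ≫ g = f := f.toNormalization_fromNormalization
  have hmem (U : X.Opens) [hU : Nonempty U] : genericPoint X ∈ U :=
    ((genericPoint_spec X).mem_open_set_iff U.isOpen).mpr (by simpa using hU)
  have hgen (U : X.Opens) [hU : Nonempty U] : f ⁻¹ᵁ U = ⊤ := by
    refine top_le_iff.1 fun p _ => ?_
    change f p ∈ U
    rw [Scheme.Hom.comp_apply, genericInclusion_apply]
    exact hmem U
  let θ (U : X.Opens) [hU : Nonempty U] : Γ(Spec (.of L), f ⁻¹ᵁ U) ≃+* L :=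
    ((Spec (.of L)).presheaf.mapIso (eqToIso (hgen U).symm).op ≪≫
      Scheme.ΓSpecIso (.of L)).commRingCatIsoToRingEquiv
  have hθ (U : X.Opens) [hU : Nonempty U] (a : Γ(X, U)) :
      θ U ((f.app U) a) = algebraMap X.functionField L (algebraMap Γ(X, U) X.functionField a) :=
    congr($(app_comp_eq_germ_comp L (CommRingCat.ofHom (algebraMap X.functionField L)) U
      (hmem U) (hgen U)) a)
  have key (U : X.Opens) [hU : Nonempty U] (hUa : IsAffineOpen U) :
      letI := (f.app U).hom.toAlgebra
      IsDedekindDomain (integralClosure Γ(X, U) Γ(Spec (.of L), f ⁻¹ᵁ U)) ∧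
        Module.Finite Γ(X, U) (integralClosure Γ(X, U) Γ(Spec (.of L), f ⁻¹ᵁ U)) ∧
        ∀ l : L, ∃ x y : integralClosure Γ(X, U) Γ(Spec (.of L), f ⁻¹ᵁ U),
          y ≠ 0 ∧ θ U x = l * θ U y := by
    let := (f.app U).hom.toAlgebra
    have := functionField_isFractionRing_of_isAffineOpen X U hUa
    have := isDedekindDomain_of_isAffineOpen hX hUa
    exact integralClosure_of_ringEquiv (F := X.functionField) (θ U) (hθ U)
  obtain ⟨τ, hτ, hτ'⟩ := exists_eq_SpecMap_comp_genericInclusion L j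
  refine ⟨B, inferInstance, g, τ, ⟨fun U hU => ?_⟩, fun b => ?_, ⟨τ.hom.injective, fun l => ?_⟩, ?_⟩
  · let := (f.app U).hom.toAlgebra
    rw [f.fromNormalization_app hU, CommRingCat.hom_comp]
    refine .comp (.of_surjective _
      (f.normalizationObjIso hU).symm.commRingCatIsoToRingEquiv.surjective) ?_
    change (algebraMap _ _).Finite
    rw [RingHom.finite_algebraMap]
    by_cases hne : Nonempty U
    · exact (key U hU).2.1
    · have hU0 : U = ⊥ := by
        rw [← TopologicalSpace.Opens.coe_eq_empty, ← Set.isEmpty_coe_sort]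
        exact not_nonempty_iff.1 hne
      have : Subsingleton Γ(Spec (.of L), f ⁻¹ᵁ U) := by
        rw [hU0, Scheme.Hom.preimage_bot]; infer_instance
      infer_instance
  · obtain ⟨_, ⟨U, hU, rfl⟩, hbU, -⟩ :=
      X.isBasis_affineOpens.exists_subset_of_mem_open (Set.mem_univ (g b)) isOpen_univ
    have hne : Nonempty U := ⟨_, hbU⟩
    let := (f.app U).hom.toAlgebra
    have h1 := (key U hU).1
    have h2 : IsDedekindDomain Γ(B, g ⁻¹ᵁ U) := by
      exact isDedekindDomain_of_ringEquiv
        (f.normalizationObjIso hU).symm.commRingCatIsoToRingEquiv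
    exact isPrincipalIdealRing_stalk_of_isDedekindDomain (hU.preimage g) (x := b) hbU h2
  · obtain ⟨_, ⟨U, hU, rfl⟩, hU', -⟩ :=
      X.isBasis_affineOpens.exists_subset_of_mem_open (Set.mem_univ (genericPoint X)) isOpen_univ
    have hne : Nonempty U := ⟨_, hU'⟩
    have hmemB : genericPoint B ∈ g ⁻¹ᵁ U := by
      have hp : j (IsLocalRing.closedPoint (CommRingCat.of L) : Spec (.of L)) ∈ g ⁻¹ᵁ U := by
        change (j ≫ g) _ ∈ U
        rw [hjg]
        exact (hgen U).ge trivial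
      exact (genericPoint_specializes _).mem_open (g ⁻¹ᵁ U).isOpen hp
    let := (f.app U).hom.toAlgebra
    -- For surjectivity of `τ`, write l as a quotient of integral elements; their germs lie in the
    -- function field of B, and so does the quotient.
    obtain ⟨x, y, hy, hxy⟩ := (key U hU).2.2 l
    have hpre : j ⁻¹ᵁ g ⁻¹ᵁ U = ⊤ := by rw [← Scheme.Hom.comp_preimage, hjg, hgen]
    have hcomm : (f.normalizationObjIso hU).inv ≫ B.presheaf.germ (g ⁻¹ᵁ U) _ hmemB ≫ τ =
        CommRingCat.ofHom
          (Subalgebra.val (integralClosure Γ(X, U) Γ(Spec (.of L), f ⁻¹ᵁ U))).toRingHom ≫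
          CommRingCat.ofHom (θ U).toRingHom := by
      rw [Iso.inv_comp_eq, hτ' _ hmemB hpre]
      refine Eq.trans ?_ (Category.assoc _ _ _)
      rw [f.normalizationObjIso_hom_val hU]
      change _ = j.appLE (g ⁻¹ᵁ U) (f ⁻¹ᵁ U) _ ≫
        (Spec (.of L)).presheaf.map (eqToHom (hgen U).symm).op ≫ (Scheme.ΓSpecIso (.of L)).hom
      rw [Scheme.Hom.appLE, Category.assoc, ← Functor.map_comp_assoc]
      rfl
    have hval (z) : τ (B.presheaf.germ (g ⁻¹ᵁ U) _ hmemB ((f.normalizationObjIso hU).inv z)) =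
        θ U z := congr($hcomm z)
    have hy' : θ U y ≠ 0 := fun h0 => hy (Subtype.ext ((map_eq_zero_iff _ (θ U).injective).1 h0))
    let a : B.functionField := B.presheaf.germ (g ⁻¹ᵁ U) _ hmemB ((f.normalizationObjIso hU).inv x)
    let b : B.functionField := B.presheaf.germ (g ⁻¹ᵁ U) _ hmemB ((f.normalizationObjIso hU).inv y)
    refine ⟨a / b, ?_⟩
    have hdiv : τ.hom (a / b) = τ.hom a / τ.hom b := map_div₀ (τ.hom : B.functionField →+* L) a b
    refine hdiv.trans ?_
    rw [div_eq_iff (by rw [show τ.hom b = _ from hval y]; exact hy')]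
    exact (hval x).trans (hxy.trans (congrArg _ (hval y).symm))
  · rw [← Category.assoc, ← hτ, hjg]

end Normalization

/-! ### Points of projective space in homogeneous coordinates -/

section HomogeneousCoordinates

open HomogeneousLocalization

attribute [local instance] MvPolynomial.gradedAlgebra

/-- The grading of `K[X_0, …, X_n]` by the spaces of forms of fixed degree. -/
noncomputable abbrev formsOf (K : Type u) [Field K] (n : ℕ) :
    ℕ → Submodule K (MvPolynomial (Fin (n + 1)) K) :=
  MvPolynomial.homogeneousSubmodule (Fin (n + 1)) K

variable {K : Type u} [Field K] {n : ℕ} {S T : Type u} [CommRing S] [CommRing T]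

lemma eval₂_mul_of_isHomogeneous (κ : K →+* S) (h : Fin (n + 1) → S) (c : S)
    {p : MvPolynomial (Fin (n + 1)) K} {d : ℕ} (hp : p ∈ formsOf K n d) :
    MvPolynomial.eval₂ κ (fun i => c * h i) p = c ^ d * MvPolynomial.eval₂ κ h p := by
  rw [MvPolynomial.eval₂_eq, MvPolynomial.eval₂_eq, Finset.mul_sum]
  refine Finset.sum_congr rfl fun m hm => ?_
  have hd := ((MvPolynomial.mem_homogeneousSubmodule _ _).1 hp) (MvPolynomial.mem_support_iff.1 hm)
  simp_rw [mul_pow, Finset.prod_mul_distrib, Finset.prod_pow_eq_pow_sum]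
  have hd' : m.degree = d := by rw [Finsupp.degree_eq_weight_one]; exact hd
  rw [← hd', Finsupp.degree_apply]
  ring

/-- Evaluation of the fractions `p / q ^ m` of degree zero at homogeneous coordinates `h`. -/
noncomputable def chartHom (κ : K →+* S) (h : Fin (n + 1) → S) (q : MvPolynomial (Fin (n + 1)) K)
    (hq : IsUnit (MvPolynomial.eval₂Hom κ h q)) : Away (formsOf K n) q →+* S :=
  (IsLocalization.Away.lift (S := Localization.Away q) q hq).comp
    (algebraMap (Away (formsOf K n) q) (Localization.Away q))

variable (κ : K →+* S) (h : Fin (n + 1) → S) {q : MvPolynomial (Fin (n + 1)) K}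
    (hq : IsUnit (MvPolynomial.eval₂Hom κ h q))

lemma chartHom_mk_mul {d : ℕ} (hd : q ∈ formsOf K n d) (m : ℕ) (p : MvPolynomial (Fin (n + 1)) K)
    (hp : p ∈ formsOf K n (m • d)) :
    chartHom κ h q hq (Away.mk (formsOf K n) hd m p hp) * MvPolynomial.eval₂Hom κ h q ^ m =
      MvPolynomial.eval₂Hom κ h p := by
  rw [chartHom, RingHom.comp_apply, HomogeneousLocalization.algebraMap_apply, Away.val_mk,
    Localization.mk_eq_mk', ← IsLocalization.Away.lift_eq (S := Localization.Away q) q hq q,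
    ← map_pow, ← map_pow, ← map_mul, IsLocalization.mk'_spec, IsLocalization.Away.lift_eq]

/-- The value of q is a unit, so these relations with cleared denominators determine the
homomorphism. The comparisons of homogeneous coordinates below go through this uniqueness. -/
lemma eq_chartHom {d : ℕ} (hd : q ∈ formsOf K n d) (ψ : Away (formsOf K n) q →+* S)
    (hψ : ∀ (m : ℕ) (p : MvPolynomial (Fin (n + 1)) K) (hp : p ∈ formsOf K n (m • d)),
      ψ (Away.mk (formsOf K n) hd m p hp) * MvPolynomial.eval₂Hom κ h q ^ m =
        MvPolynomial.eval₂Hom κ h p) :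
    ψ = chartHom κ h q hq := by
  ext z
  obtain ⟨m, p, hp, rfl⟩ := Away.mk_surjective (formsOf K n) hd z
  exact (hq.pow m).mul_left_injective ((hψ m p hp).trans (chartHom_mk_mul κ h hq hd m p hp).symm)

lemma chartHom_fromZeroRingHom (a : K) :
    chartHom κ h q hq (fromZeroRingHom (formsOf K n) _ (algebraMap K (formsOf K n 0) a)) = κ a := by
  have : (fromZeroRingHom (formsOf K n) (Submonoid.powers q) (algebraMap K (formsOf K n 0) a)).val =
    algebraMap (MvPolynomial (Fin (n + 1)) K) (Localization.Away q) (MvPolynomial.C a) := rfl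
  rw [chartHom, RingHom.comp_apply, HomogeneousLocalization.algebraMap_apply, this,
    IsLocalization.Away.lift_eq]
  simp

variable {κ h} in
lemma isUnit_X {i : Fin (n + 1)} (hi : IsUnit (h i)) :
    IsUnit (MvPolynomial.eval₂Hom κ h (MvPolynomial.X i)) := by simpa using hi

lemma X_mem (i : Fin (n + 1)) : (MvPolynomial.X i : MvPolynomial (Fin (n + 1)) K) ∈ formsOf K n 1 :=
  (MvPolynomial.mem_homogeneousSubmodule _ _).2 (MvPolynomial.isHomogeneous_X K i)

/-- The point of projective space with homogeneous coordinates `h`, if `h i` is a unit. -/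
noncomputable def chartPoint (i : Fin (n + 1)) (hi : IsUnit (h i)) :
    Spec (.of S) ⟶ Proj (formsOf K n) :=
  Spec.map (CommRingCat.ofHom (chartHom κ h _ (isUnit_X hi))) ≫
    Proj.awayι (formsOf K n) (MvPolynomial.X i) (X_mem i) one_pos

lemma chartPoint_comp (φ : S →+* T) (i : Fin (n + 1)) (hi : IsUnit (h i)) :
    Spec.map (CommRingCat.ofHom φ) ≫ chartPoint κ h i hi =
      chartPoint (φ.comp κ) (φ ∘ h) i (hi.map φ) := by
  rw [chartPoint, chartPoint, ← Category.assoc, ← Spec.map_comp, ← CommRingCat.ofHom_comp]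
  congr 3
  refine eq_chartHom _ _ _ (X_mem i) _ fun m p hp => ?_
  have h1 (r : MvPolynomial (Fin (n + 1)) K) :
      MvPolynomial.eval₂Hom (φ.comp κ) (φ ∘ h) r = φ (MvPolynomial.eval₂Hom κ h r) :=
    (MvPolynomial.hom_eval₂ r κ φ h).symm
  rw [h1, h1, ← map_pow, RingHom.comp_apply, ← map_mul, chartHom_mk_mul]

/-- Numerator and denominator of a fraction of degree zero acquire the same power of c. -/
lemma chartPoint_mul (c : S) (hc : IsUnit c) (i : Fin (n + 1)) (hi : IsUnit (h i))
    (hi' : IsUnit (c * h i)) :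
    chartPoint κ (fun i => c * h i) i hi' = chartPoint κ h i hi := by
  rw [chartPoint, chartPoint]
  congr 3
  refine eq_chartHom _ _ _ (X_mem i) _ fun m p hp => ?_
  have h1 := chartHom_mk_mul κ (fun i => c * h i) (isUnit_X hi') (X_mem i) m p hp
  rw [MvPolynomial.coe_eval₂Hom, eval₂_mul_of_isHomogeneous κ h c hp,
    eval₂_mul_of_isHomogeneous κ h c (X_mem i)] at h1
  refine (hc.pow m).mul_right_injective ?_
  simp only [smul_eq_mul, mul_one, pow_one, mul_pow] at h1
  simp only [MvPolynomial.coe_eval₂Hom]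
  rw [← h1]
  ring

/-- Both points factor through the chart where X_i X_j is invertible, and there they are given by
the same homomorphism. -/
lemma chartPoint_eq (i j : Fin (n + 1)) (hi : IsUnit (h i)) (hj : IsUnit (h j)) :
    chartPoint κ h i hi = chartPoint κ h j hj := by
  have key (i j : Fin (n + 1)) (hi : IsUnit (h i)) (hj : IsUnit (h j))
      (q : MvPolynomial (Fin (n + 1)) K) (hq : q = MvPolynomial.X i * MvPolynomial.X j)
      (hq' : q ∈ formsOf K n (1 + 1)) (hij : IsUnit (MvPolynomial.eval₂Hom κ h q)) :
      chartPoint κ h i hi = Spec.map (CommRingCat.ofHom (chartHom κ h _ hij)) ≫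
        Proj.awayι (formsOf K n) q hq' (by norm_num) := by
    rw [← Proj.SpecMap_awayMap_awayι (formsOf K n) (X_mem i) one_pos (X_mem j) hq, ← Category.assoc,
      ← Spec.map_comp, ← CommRingCat.ofHom_comp, chartPoint]
    congr 3
    symm
    refine eq_chartHom _ _ _ (X_mem i) _ fun m p hp => ?_
    rw [RingHom.comp_apply, awayMap_mk]
    have h1 := chartHom_mk_mul κ h hij hq' m (p * MvPolynomial.X j ^ m) (by
        rw [smul_add]; exact SetLike.mul_mem_graded hp (SetLike.pow_mem_graded m (X_mem j)))
    refine (hj.pow m).mul_left_injective ?_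
    subst hq
    simp only [map_mul, map_pow, mul_pow, MvPolynomial.eval₂Hom_X'] at h1 ⊢
    rw [← h1]
    ring
  have hij : IsUnit (MvPolynomial.eval₂Hom κ h (MvPolynomial.X i * MvPolynomial.X j)) := by
    simpa using ⟨hi, hj⟩
  have hq := SetLike.mul_mem_graded (A := (formsOf K n)) (X_mem (K := K) i) (X_mem j)
  rw [key i j hi hj _ rfl hq hij, key j i hj hi _ (mul_comm _ _) hq hij]

lemma chartPoint_comp_projectiveSpaceToSpec (i : Fin (n + 1)) (hi : IsUnit (h i)) :
    chartPoint κ h i hi ≫ projectiveSpaceToSpec K n = Spec.map (CommRingCat.ofHom κ) := by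
  rw [chartPoint, projectiveSpaceToSpec, Category.assoc, Proj.awayι_toSpecZero_assoc,
    ← Spec.map_comp, ← Spec.map_comp]
  congr 1
  ext a
  exact chartHom_fromZeroRingHom κ h (isUnit_X hi) a

lemma mem_range_chartHom (i j : Fin (n + 1)) (hi : h i = 1) (hi' : IsUnit (h i)) :
    h j ∈ (chartHom κ h (MvPolynomial.X i) (isUnit_X hi')).range := by
  refine ⟨Away.mk (formsOf K n) (X_mem i) 1 (MvPolynomial.X j) (by simpa using X_mem j), ?_⟩
  have := chartHom_mk_mul κ h (isUnit_X hi') (X_mem i) 1 (MvPolynomial.X j) (by simpa using X_mem j)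
  simpa [hi] using this

end HomogeneousCoordinates

/-! ### Local rings inside the function field -/

section LocalSubring

variable {X P : Scheme.{u}}

lemma isDominant_SpecMap_of_injective {R S : CommRingCat.{u}} (φ : R ⟶ S)
    (h : Function.Injective φ) : IsDominant (Spec.map φ) := by
  refine ⟨(PrimeSpectrum.denseRange_comap_iff_ker_le_nilRadical φ.hom).2 ?_⟩
  rw [(RingHom.injective_iff_ker_eq_bot φ.hom).1 h]
  exact bot_le

/-- If the morphism induced by `f` on `Spec 𝒪_{X, b}` factors as `ψ` into an affine open subscheme,
then the image of `ψ` lies in the image of the map on local rings at `b`. -/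
lemma mem_range_stalkMap {A : CommRingCat.{u}} (f : X ⟶ P) (b : X) (ψ : A ⟶ X.presheaf.stalk b)
    (ι : Spec A ⟶ P) [IsOpenImmersion ι] (h : Spec.map ψ ≫ ι = X.fromSpecStalk b ≫ f) (a : A) :
    ∃ o, f.stalkMap b o = ψ a := by
  let c : Spec (X.presheaf.stalk b) := IsLocalRing.closedPoint (X.presheaf.stalk b)
  have hc : X.fromSpecStalk b c = b := Scheme.fromSpecStalk_closedPoint
  obtain ⟨z, hz⟩ : ∃ z : Spec A, f b = ι z := by
    refine ⟨Spec.map ψ c, ?_⟩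
    have h1 := congr($h c)
    rw [Scheme.Hom.comp_apply, Scheme.Hom.comp_apply, hc] at h1
    exact h1.symm
  let μ : (Spec A).presheaf.stalk z ⟶ P.presheaf.stalk (ι z) := inv (ι.stalkMap z)
  let τ : A ⟶ (Spec A).presheaf.stalk z := StructureSheaf.toStalk A z
  have hτ : Spec.map τ = (Spec A).fromSpecStalk z := (Spec.fromSpecStalk_eq' A z).symm
  -- Since `ι` is an open immersion, the localization of A at z is the local ring of P at f(b). Thus
  -- ν passes through the map of local rings, and it equals ψ because `ι` is a monomorphism.
  let ν : A ⟶ X.presheaf.stalk b := (τ ≫ μ ≫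
    P.presheaf.stalkSpecializes (specializes_of_eq hz)) ≫ f.stalkMap b
  have hν : ν = ψ := by
    apply Spec.map_injective
    rw [← cancel_mono ι, h]
    simp only [ν, Spec.map_comp, Category.assoc]
    rw [hτ]
    have h2 : Spec.map μ ≫ (Spec A).fromSpecStalk z ≫ ι =
        P.fromSpecStalk (ι z) := by
      rw [Spec.map_inv, IsIso.inv_comp_eq, Scheme.SpecMap_stalkMap_fromSpecStalk]
    rw [h2]
    rw [Scheme.SpecMap_stalkSpecializes_fromSpecStalk, Scheme.SpecMap_stalkMap_fromSpecStalk]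
  exact ⟨_, congr($hν a)⟩

variable [IsIntegral X]

/-- The local ring at a point, as a subring of the function field. -/
noncomputable def localSubring (b : X) : Subring X.functionField :=
  (algebraMap (X.presheaf.stalk b) X.functionField).range

/-- Points of a separated integral scheme are determined by their local rings. -/
lemma localSubring_injective [X.IsSeparated] :
    Function.Injective (localSubring : X → Subring X.functionField) := by
  intro b b' h
  have hinj (c : X) : Function.Injective (algebraMap (X.presheaf.stalk c) X.functionField) :=
    IsFractionRing.injective _ _
  let e (c : X) : X.presheaf.stalk c ≃+* localSubring c :=
    .ofBijective (algebraMap (X.presheaf.stalk c) X.functionField).rangeRestrict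
      ⟨fun x y hxy => hinj c (congrArg Subtype.val hxy), RingHom.rangeRestrict_surjective _⟩
  have he (c : X) (x : X.presheaf.stalk c) : (e c x : X.functionField) =
    algebraMap (X.presheaf.stalk c) X.functionField x := rfl
  -- Equal subrings give an isomorphism of stalks compatible with the function field. By
  -- separatedness it identifies the two morphisms from the local spectra to X, and it matches their
  -- closed points, which map to b and b'.
  let ε : X.presheaf.stalk b ≃+* X.presheaf.stalk b' :=
    ((e b).trans (RingEquiv.subringCongr h)).trans (e b').symm
  have hε (x : X.presheaf.stalk b) : algebraMap (X.presheaf.stalk b') X.functionField (ε x) =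
      algebraMap (X.presheaf.stalk b) X.functionField x := by
    rw [← he, ← he]
    exact congrArg Subtype.val ((e b').apply_symm_apply _)
  let ψ : X.presheaf.stalk b ⟶ X.presheaf.stalk b' := CommRingCat.ofHom ε.toRingHom
  have hdom := isDominant_SpecMap_of_injective
    (X.presheaf.stalkSpecializes (genericPoint_specializes b')) (hinj b')
  have h1 : Spec.map ψ ≫ X.fromSpecStalk b = X.fromSpecStalk b' := by
    refine ext_of_isDominant
      (Spec.map (X.presheaf.stalkSpecializes (genericPoint_specializes b'))) ?_
    rw [Scheme.SpecMap_stalkSpecializes_fromSpecStalk, ← Category.assoc, ← Spec.map_comp,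
      ← Scheme.SpecMap_stalkSpecializes_fromSpecStalk (genericPoint_specializes b)]
    congr 2
    ext x
    exact hε x
  let c : Spec (X.presheaf.stalk b) := IsLocalRing.closedPoint (X.presheaf.stalk b)
  let c' : Spec (X.presheaf.stalk b') := IsLocalRing.closedPoint (X.presheaf.stalk b')
  have hc : X.fromSpecStalk b c = b := Scheme.fromSpecStalk_closedPoint
  have hc' : X.fromSpecStalk b' c' = b' := Scheme.fromSpecStalk_closedPoint
  have : IsLocalHom ψ.hom := ⟨fun a (ha : IsUnit (ε a)) => (MulEquiv.isUnit_map ε).1 ha⟩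
  have h2 : Spec.map ψ c' = c := IsLocalRing.comap_closedPoint ψ.hom
  rw [← hc, ← hc', ← h2, ← Scheme.Hom.comp_apply, h1]

end LocalSubring

/-! ### Projective embeddings from finitely many rational functions -/

section Projective

variable {K : Type u} [Field K]

/-- The structure map from the base field to the function field. -/
noncomputable def baseHom (X : Over (Spec (CommRingCat.of K))) [IsIntegral X.left] :
    K →+* X.left.functionField :=
  (Spec.preimage (genericInclusion X.left ≫ X.hom)).hom

lemma SpecMap_baseHom (X : Over (Spec (CommRingCat.of K))) [IsIntegral X.left] :
    Spec.map (CommRingCat.ofHom (baseHom X)) = genericInclusion X.left ≫ X.hom :=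
  Spec.map_preimage _

variable (X : Over (Spec (CommRingCat.of K))) [IsIntegral X.left]

/-- An affine open set is of finite type over K, so the constants and finitely many germs generate
all its sections. The element 1 is put into T so that every chart offers a nonzero generator. -/
lemma exists_generators [LocallyOfFiniteType X.hom] {U : X.left.Opens} (hU : IsAffineOpen U)
    (hη : genericPoint X.left ∈ U) :
    ∃ T : Finset X.left.functionField, 1 ∈ T ∧
      (∀ t ∈ T, ∃ s, X.left.presheaf.germ U _ hη s = t) ∧
      ∀ S : Subring X.left.functionField, (baseHom X).range ≤ S →
        (T : Set X.left.functionField) ⊆ S →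
        ∀ s, X.left.presheaf.germ U _ hη s ∈ S := by
  classical
  have hle : U ≤ X.hom ⁻¹ᵁ ⊤ := le_top
  have hft := X.hom.finiteType_appLE (isAffineOpen_top _) hU hle
  let κ : Γ(Spec (.of K), ⊤) ⟶ Γ(X.left, U) := X.hom.appLE ⊤ U hle
  have hκ : κ ≫ X.left.presheaf.germ U _ hη =
      (Scheme.ΓSpecIso (.of K)).hom ≫ CommRingCat.ofHom (baseHom X) := by
    have h1 : κ ≫ X.left.presheaf.germ U _ hη =
        X.hom.appTop ≫ X.left.presheaf.germ ⊤ (genericPoint X.left) trivial := by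
      change (X.hom.app ⊤ ≫ X.left.presheaf.map (homOfLE hle).op) ≫ _ = _
      rw [Category.assoc, TopCat.Presheaf.germ_res]
      rfl
    have h2 : (Spec.map (CommRingCat.ofHom (baseHom X))).appTop ≫ (Scheme.ΓSpecIso _).hom =
        X.hom.appTop ≫ X.left.presheaf.germ ⊤ (genericPoint X.left) trivial := by
      rw [SpecMap_baseHom, Scheme.Hom.comp_appTop, Category.assoc, Scheme.fromSpecStalk_appTop]
      simp
    rw [h1, ← h2, Scheme.ΓSpecIso_naturality]
  let := κ.hom.toAlgebra
  obtain ⟨T, hT⟩ : Algebra.FiniteType Γ(Spec (.of K), ⊤) Γ(X.left, U) := hft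
  refine ⟨insert 1 (T.image (X.left.presheaf.germ U _ hη)), Finset.mem_insert_self _ _, ?_, ?_⟩
  · intro t ht
    rcases Finset.mem_insert.1 ht with rfl | ht
    · exact ⟨1, map_one _⟩
    · obtain ⟨s, -, rfl⟩ := Finset.mem_image.1 ht
      exact ⟨s, rfl⟩
  · intro S hS hTS s
    have hs : s ∈ Algebra.adjoin Γ(Spec (.of K), ⊤) (T : Set Γ(X.left, U)) := by
      rw [hT]; trivial
    induction hs using Algebra.adjoin_induction with
    | mem x hx =>
      exact hTS (Finset.mem_coe.2 (Finset.mem_insert_of_mem (Finset.mem_image_of_mem _ hx)))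
    | algebraMap r => exact hS ⟨(Scheme.ΓSpecIso (.of K)).hom r, congr($hκ r).symm⟩
    | add x y _ _ hx hy => rw [map_add]; exact add_mem hx hy
    | mul x y _ _ hx hy => rw [map_mul]; exact mul_mem hx hy

/-- Take t of largest valuation; it is nonzero because 1 belongs to T. -/
lemma exists_forall_div_mem {O F : Type*} [CommRing O] [IsDomain O] [ValuationRing O] [Field F]
    [Algebra O F] [IsFractionRing O F] (T : Finset F) (h1 : 1 ∈ T) :
    ∃ t ∈ T, t ≠ 0 ∧ ∀ t' ∈ T, t' / t ∈ (algebraMap O F).range := by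
  obtain ⟨t, ht, hmax⟩ := T.exists_max_image (ValuationRing.valuation O F) ⟨1, h1⟩
  have ht0 : t ≠ 0 := by
    rintro rfl
    have := hmax 1 h1
    rw [map_one, map_zero] at this
    exact absurd this (not_le.2 zero_lt_one)
  refine ⟨t, ht, ht0, fun t' ht' => ?_⟩
  rw [RingHom.mem_range, ← ValuationRing.mem_integer_iff, Valuation.mem_integer_iff, map_div₀]
  exact div_le_one_of_le₀ (hmax t' ht') zero_le

end Projective

attribute [local instance] MvPolynomial.gradedAlgebra

section Projective

/-- Elements of the stalk are fractions of germs from U. Stalk maps are local, so a preimage of an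
invertible denominator is again invertible. -/
lemma stalkMap_surjective_of_germ_mem {X P : Scheme.{u}} [IsIntegral X] (f : X ⟶ P) (b : X)
    {U : X.Opens} (hU : IsAffineOpen U) (hb : b ∈ U)
    (h : ∀ s, ∃ o, f.stalkMap b o = X.presheaf.germ U b hb s) :
    Function.Surjective (f.stalkMap b) := by
  intro x
  let := X.presheaf.algebra_section_stalk ⟨b, hb⟩
  have := hU.isLocalization_stalk ⟨b, hb⟩
  obtain ⟨⟨s, t⟩, hst⟩ := IsLocalization.surj (hU.primeIdealOf ⟨b, hb⟩).asIdeal.primeCompl x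
  obtain ⟨o, ho⟩ := h s
  obtain ⟨o', ho'⟩ := h t
  have hst' : x * X.presheaf.germ U b hb t = X.presheaf.germ U b hb s := hst
  have ht : IsUnit (X.presheaf.germ U b hb t) :=
    IsLocalization.map_units (M := (hU.primeIdealOf ⟨b, hb⟩).asIdeal.primeCompl)
      (X.presheaf.stalk b) t
  have hu : IsUnit o' := by
    rw [← ho'] at ht
    exact isUnit_of_map_unit (f.stalkMap b).hom _ ht
  obtain ⟨w, rfl⟩ := hu
  refine ⟨o * ↑w⁻¹, ht.mul_left_injective ?_⟩
  change _ * _ = x * _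
  rw [hst', ← ho', ← map_mul, mul_assoc, Units.inv_mul, mul_one, ho]

/-- With surjective stalk maps, the local ring of X at b inside the function field is the image of
the local ring of P at f(b). It depends only on f(b), and it determines b by separatedness. -/
lemma injective_of_stalkMap_surjective {X P : Scheme.{u}} [IsIntegral X] [X.IsSeparated]
    (f : X ⟶ P) (h : ∀ b, Function.Surjective (f.stalkMap b)) : Function.Injective f := by
  have key (b : X) (y : P) (hy : f b = y) :
      ∃ ψ : P.presheaf.stalk y ⟶ X.presheaf.stalk (genericPoint X),
      Spec.map ψ ≫ P.fromSpecStalk y = genericInclusion X ≫ f ∧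
        (localSubring b : Set X.functionField) = Set.range ψ := by
    subst hy
    refine ⟨f.stalkMap b ≫ X.presheaf.stalkSpecializes (genericPoint_specializes b), ?_, ?_⟩
    · rw [Spec.map_comp, Category.assoc, Scheme.SpecMap_stalkMap_fromSpecStalk,
        Scheme.SpecMap_stalkSpecializes_fromSpecStalk_assoc]
    · ext z
      constructor
      · rintro ⟨o, rfl⟩
        obtain ⟨o, rfl⟩ := h b o
        exact ⟨o, rfl⟩
      · rintro ⟨o, rfl⟩
        exact ⟨_, rfl⟩
  intro b b' hb
  obtain ⟨ψ, h1, h2⟩ := key b _ hb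
  obtain ⟨ψ', h1', h2'⟩ := key b' _ rfl
  have : ψ = ψ' := Spec.map_injective ((cancel_mono (P.fromSpecStalk (f b'))).1 (h1.trans h1'.symm))
  exact localSubring_injective (SetLike.coe_injective (by rw [h2, h2', this]))

variable {K : Type u} [Field K] (X : Over (Spec (CommRingCat.of K))) [IsIntegral X.left]

lemma exists_localBaseHom (b : X.left) : ∃ κ : K →+* X.left.presheaf.stalk b,
    Spec.map (CommRingCat.ofHom κ) = X.left.fromSpecStalk b ≫ X.hom ∧
    (algebraMap (X.left.presheaf.stalk b) X.left.functionField).comp κ = baseHom X := by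
  obtain ⟨κ, hκ⟩ := Spec.map_surjective (X.left.fromSpecStalk b ≫ X.hom)
  refine ⟨κ.hom, hκ, ?_⟩
  have : κ ≫ X.left.presheaf.stalkSpecializes (genericPoint_specializes b) =
      CommRingCat.ofHom (baseHom X) := by
    apply Spec.map_injective
    rw [SpecMap_baseHom, Spec.map_comp, hκ, Scheme.SpecMap_stalkSpecializes_fromSpecStalk_assoc]
  exact congrArg CommRingCat.Hom.hom this

instance (n : ℕ) :
    (Proj (MvPolynomial.homogeneousSubmodule (Fin (n + 1)) K)).IsSeparated := by
  have : IsSeparated (CategoryTheory.Limits.terminal.from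
      (Proj (MvPolynomial.homogeneousSubmodule (Fin (n + 1)) K))) := by
    rw [← Limits.terminal.comp_from (projectiveSpaceToSpec K n)]
    infer_instance
  exact ⟨this⟩

variable {X}

/-- After division by h k the coordinates lie in the local ring at b and the k-th one is 1. So f
maps Spec of that local ring into the chart X_k ≠ 0, where the ratios are values of the functions
X_j / X_k. -/
lemma div_mem_range_stalkMap {n : ℕ} {h : Fin (n + 1) → X.left.functionField} {i : Fin (n + 1)}
    (hi : IsUnit (h i))
    {f : X.left ⟶ Proj (MvPolynomial.homogeneousSubmodule (Fin (n + 1)) K)}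
    (hf : genericInclusion X.left ≫ f = chartPoint (baseHom X) h i hi) {b : X.left}
    {k : Fin (n + 1)} (hk : h k ≠ 0) (hkb : ∀ j, h j / h k ∈ localSubring b) :
    (baseHom X).range ≤ ((algebraMap (X.left.presheaf.stalk b) X.left.functionField).comp
        (f.stalkMap b).hom).range ∧
      ∀ j, h j / h k ∈ ((algebraMap (X.left.presheaf.stalk b) X.left.functionField).comp
        (f.stalkMap b).hom).range := by
  obtain ⟨κ, hκ, hκ'⟩ := exists_localBaseHom X b
  have hinj : Function.Injective (algebraMap (X.left.presheaf.stalk b) X.left.functionField) :=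
    IsFractionRing.injective _ _
  choose w hw using hkb
  have hwk : w k = 1 := hinj (by rw [hw, div_self hk, map_one])
  have hwk' : IsUnit (w k) := hwk ▸ isUnit_one
  have hdom := isDominant_SpecMap_of_injective
    (X.left.presheaf.stalkSpecializes (genericPoint_specializes b)) hinj
  have h1 : chartPoint κ w k hwk' = X.left.fromSpecStalk b ≫ f := by
    refine ext_of_isDominant
      (Spec.map (X.left.presheaf.stalkSpecializes (genericPoint_specializes b))) ?_
    rw [Scheme.SpecMap_stalkSpecializes_fromSpecStalk_assoc, hf,
      chartPoint_eq _ _ i k hi (isUnit_iff_ne_zero.2 hk)]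
    refine (chartPoint_comp κ w (algebraMap (X.left.presheaf.stalk b) X.left.functionField)
      k hwk').trans ?_
    have hk' : IsUnit ((h k)⁻¹ * h k) := by rw [inv_mul_cancel₀ hk]; exact isUnit_one
    rw [← chartPoint_mul (baseHom X) h (h k)⁻¹ (isUnit_iff_ne_zero.2 (inv_ne_zero hk)) k
      (isUnit_iff_ne_zero.2 hk) hk']
    have hw' : algebraMap (X.left.presheaf.stalk b) X.left.functionField ∘ w =
        fun i => (h k)⁻¹ * h i := by
      ext j
      rw [Function.comp_apply, hw, div_eq_inv_mul]
    congr 1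
  have key := mem_range_stalkMap f b _ _ h1
  constructor
  · rintro _ ⟨a, rfl⟩
    obtain ⟨o, ho⟩ := key (HomogeneousLocalization.fromZeroRingHom
      (MvPolynomial.homogeneousSubmodule (Fin (n + 1)) K) _ (algebraMap K _ a))
    refine ⟨o, ?_⟩
    rw [← hκ']
    exact congrArg (algebraMap (X.left.presheaf.stalk b) X.left.functionField)
      (ho.trans (chartHom_fromZeroRingHom κ w (isUnit_X hwk') a))
  · intro j
    obtain ⟨a, ha⟩ := mem_range_chartHom κ w k j hwk hwk'
    obtain ⟨o, ho⟩ := key a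
    refine ⟨o, ?_⟩
    rw [← hw]
    exact congrArg (algebraMap (X.left.presheaf.stalk b) X.left.functionField) (ho.trans ha)

end Projective

attribute [local instance] MvPolynomial.gradedAlgebra

section Projective

variable {K : Type u} [Field K]

/-- A proper integral scheme over a field all of whose local rings are valuation rings is
projective. -/
theorem isProjectiveOver_of_isProper (X : Over (Spec (CommRingCat.of K))) [IsIntegral X.left]
    [IsProper X.hom] (hX : ∀ x : X.left, ValuationRing (X.left.presheaf.stalk x)) :
    IsProjectiveOver X := by
  classical
  have hsep : X.left.IsSeparated := by
    constructor
    rw [← Limits.terminal.comp_from X.hom]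
    infer_instance
  have : CompactSpace X.left := by
    have := QuasiCompact.compactSpace_of_compactSpace X.hom
    exact this
  choose U hU hxU _ using fun x : X.left => exists_isAffineOpen_mem_and_subset
    (U := ⊤) (x := x) trivial
  have hη (x : X.left) : genericPoint X.left ∈ U x :=
    ((genericPoint_spec X.left).mem_open_set_iff (U x).isOpen).2 ⟨x, trivial, hxU x⟩
  obtain ⟨t, ht⟩ := (isCompact_univ (X := X.left)).elim_nhds_subcover (fun x => (U x : Set X.left))
    fun x _ => (U x).isOpen.mem_nhds (hxU x)
  choose T hT1 hTU hT using fun x => exists_generators X (hU x) (hη x)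
  -- As in a Segre embedding, the homogeneous coordinates are all products with one generator from
  -- each chart of a finite affine cover. The product of ones is an invertible coordinate.
  let ι : Type u := (x : t) → T x
  let k₀ : ι := fun x => ⟨1, hT1 x⟩
  obtain ⟨n, hn⟩ : ∃ n, Fintype.card ι = n + 1 :=
    Nat.exists_eq_succ_of_ne_zero (have : Nonempty ι := ⟨k₀⟩; Fintype.card_ne_zero)
  let e : ι ≃ Fin (n + 1) := (Fintype.equivFin ι).trans (finCongr hn)
  let m (k : ι) : X.left.functionField := ∏ x, (k x : X.left.functionField)
  let h (j : Fin (n + 1)) : X.left.functionField := m (e.symm j)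
  have he (k : ι) : h (e k) = m k := congrArg m (e.symm_apply_apply k)
  have hi : IsUnit (h (e k₀)) := by
    rw [he, show m k₀ = 1 from Finset.prod_const_one]
    exact isUnit_one
  obtain ⟨f, hfX, hf⟩ := exists_hom_of_generic X.hom (projectiveSpaceToSpec K n) hX
    (chartPoint (baseHom X) h (e k₀) hi)
    ((chartPoint_comp_projectiveSpaceToSpec _ _ _ _).trans (SpecMap_baseHom X))
  refine ⟨n, f, ?_, hfX⟩
  have hsurj (b : X.left) : Function.Surjective (f.stalkMap b) := by
    have hinj : Function.Injective (algebraMap (X.left.presheaf.stalk b) X.left.functionField) :=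
      IsFractionRing.injective _ _
    obtain ⟨x₀, hx₀, hb⟩ : ∃ x ∈ t, b ∈ U x := by simpa using ht.2 (Set.mem_univ b)
    have hgerm (s) : X.left.presheaf.germ (U x₀) _ (hη x₀) s =
        algebraMap (X.left.presheaf.stalk b) X.left.functionField
          (X.left.presheaf.germ (U x₀) b hb s) :=
      (X.left.presheaf.germ_stalkSpecializes_apply hb (genericPoint_specializes b) s).symm
    have hval := hX b
    -- The denominator at b uses a generator of largest valuation in each chart. In the chart `x₀`
    -- containing b it is 1, which works because all generators of that chart are regular at b.
    have hk (x : t) : ∃ y ∈ T x, y ≠ 0 ∧ (∀ y' ∈ T x, y' / y ∈ localSubring b) ∧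
        (x = x₀ → y = 1) := by
      by_cases hx : (x : X.left) = x₀
      · refine ⟨1, hT1 x, one_ne_zero, fun y hy => ?_, fun _ => rfl⟩
        rw [hx] at hy
        obtain ⟨s, rfl⟩ := hTU _ _ hy
        rw [div_one, hgerm]
        exact ⟨_, rfl⟩
      · obtain ⟨y, hy, hy0, hyT⟩ := exists_forall_div_mem (O := X.left.presheaf.stalk b)
          (T x) (hT1 x)
        exact ⟨y, hy, hy0, hyT, fun h => absurd h hx⟩
    choose y hyT hy0 hy hy1 using hk
    let k : ι := fun x => ⟨y x, hyT x⟩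
    have hdiv (k' : ι) : m k' / m k = ∏ x, (k' x : X.left.functionField) / y x :=
      (Finset.prod_div_distrib ..).symm
    have hkne : h (e k) ≠ 0 := by
      rw [he]
      exact Finset.prod_ne_zero_iff.2 fun x _ => hy0 x
    obtain ⟨h1, h2⟩ := div_mem_range_stalkMap hi hf (b := b) hkne fun j => by
      rw [he, ← e.apply_symm_apply j, he, hdiv]
      exact prod_mem fun x _ => hy x _ (e.symm j x).2
    refine stalkMap_surjective_of_germ_mem f b (hU x₀) hb fun s => ?_
    obtain ⟨o, ho⟩ := hT x₀ _ h1 (fun z hz => by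
      -- Changing only the factor at `x₀` from 1 to z makes the ratio of the two coordinates equal
      -- to z. So every generator of the chart around b lies in the image.
      have h3 := h2 (e (Function.update k ⟨x₀, hx₀⟩ ⟨z, hz⟩))
      rw [he, he, hdiv, Fintype.prod_eq_single ⟨x₀, hx₀⟩] at h3
      · simpa [hy1] using h3
      · intro x hx
        rw [Function.update_of_ne hx]
        exact div_self (hy0 x)) s
    exact ⟨o, hinj (ho.trans (hgerm s))⟩
  have hprop : IsProper f := by
    have : IsProper (f ≫ projectiveSpaceToSpec K n) := by rwa [hfX]
    exact IsProper.of_comp f (projectiveSpaceToSpec K n)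
  exact { stalkMap_surjective := hsurj
          isClosedEmbedding := .of_continuous_injective_isClosedMap f.continuous
            (injective_of_stalkMap_surjective f hsurj) f.isClosedMap }

end Projective

/-! ### Intermediate fields as function fields of curves -/

lemma topologicalKrullDim_eq_one {X : Scheme.{u}} [IsIntegral X]
    (hX : ∀ x : X, IsPrincipalIdealRing (X.presheaf.stalk x)) {x : X} (hx : x ≠ genericPoint X) :
    topologicalKrullDim X = 1 := by
  refine le_antisymm (Order.krullDim_le_one_iff.2 fun Z => ?_) (Order.one_le_krullDim_iff.2 ?_)
  · obtain ⟨z, hz⟩ := QuasiSober.sober Z.isIrreducible Z.isClosed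
    by_cases hzX : z = genericPoint X
    · right
      intro W _
      have : (Z : Set X) = Set.univ := by
        rw [← (genericPoint_spec X).def, ← hzX, hz.def]
      intro y _
      have hy : y ∈ (Z : Set X) := by rw [this]; trivial
      exact hy
    · left
      intro W hW
      obtain ⟨w, hw⟩ := QuasiSober.sober W.isIrreducible W.isClosed
      have hwz : z ⤳ w := hz.specializes (hW (hw.mem))
      obtain ⟨p, hp⟩ : z ∈ Set.range (X.fromSpecStalk w) := by
        rw [Scheme.range_fromSpecStalk]; exact hwz
      let c : Spec (X.presheaf.stalk w) := IsLocalRing.closedPoint (X.presheaf.stalk w)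
      have hc : X.fromSpecStalk w c = w := Scheme.fromSpecStalk_closedPoint
      have hpri := hX w
      -- The zero ideal corresponds to the generic point. So p is a nonzero prime of a principal
      -- ideal domain, hence maximal, and z = w.
      have hp0 : p.asIdeal ≠ ⊥ := by
        intro h0
        apply hzX
        obtain ⟨q, hq⟩ : genericPoint X ∈ Set.range (X.fromSpecStalk w) := by
          rw [Scheme.range_fromSpecStalk]; exact genericPoint_specializes w
        have hpq : p ⤳ q := (PrimeSpectrum.le_iff_specializes p q).1
          (show p.asIdeal ≤ q.asIdeal by rw [h0]; exact bot_le)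
        have h1 := hpq.map (X.fromSpecStalk w).continuous
        rw [hp, hq] at h1
        exact (h1.antisymm (genericPoint_specializes z)).eq
      have hmax : p.asIdeal.IsMaximal := p.isPrime.isMaximal hp0
      have hpc : p = c := PrimeSpectrum.ext (IsLocalRing.eq_maximalIdeal hmax)
      have hzw : z = w := by rw [← hp, hpc, hc]
      subst hzw
      have : (Z : Set X) = W := hz.def.symm.trans hw.def
      exact this.le
  · refine ⟨⟨closure {x}, isIrreducible_singleton.closure, isClosed_closure⟩,
      ⟨Set.univ, IrreducibleSpace.isIrreducible_univ X, isClosed_univ⟩, ?_⟩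
    refine lt_of_le_of_ne (Set.subset_univ _) fun h => hx ?_
    have h' : closure {x} = Set.univ :=
      congrArg (fun s : TopologicalSpace.IrreducibleCloseds X => (s : Set X)) h
    exact IsGenericPoint.eq h' (genericPoint_spec X)

/-- Surjectivity survives base change, so each base change of Y is a continuous image of an
irreducible space. -/
lemma geometricallyIrreducible_of_surjective {X Y S : Scheme.{u}} (f : X ⟶ Y) [Surjective f]
    (g : Y ⟶ S) [GeometricallyIrreducible (f ≫ g)] : GeometricallyIrreducible g := by
  refine ⟨fun E _ y Z fst snd h => ?_⟩
  have hW := (IsPullback.of_hasPullback f fst).paste_vert h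
  have : IrreducibleSpace ↥(Limits.pullback f fst) :=
    GeometricallyIrreducible.geometrically_irreducibleSpace _ _ _ hW
  exact (Limits.pullback.snd f fst).surjective.irreducibleSpace
    (Limits.pullback.snd f fst).continuous

variable {K : Type u} [Field K] {C D : Curve K}

lemma baseHom_eq_comp (φ : C ⟶ D) (h : Nonconstant φ) :
    baseHom C.obj = (functionFieldMap φ h).comp (baseHom D.obj) := by
  have : CommRingCat.ofHom (baseHom C.obj) =
      CommRingCat.ofHom ((functionFieldMap φ h).comp (baseHom D.obj)) := by
    apply Spec.map_injective
    rw [SpecMap_baseHom, CommRingCat.ofHom_comp, Spec.map_comp, SpecMap_baseHom]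
    exact (isOverBase_functionFieldMap φ h).symm
  exact congrArg CommRingCat.Hom.hom this

/-- K(C) is generated as a field over K by finitely many germs, and each of them is separable, hence
integral, over K(D). -/
instance finiteDimensional_sourceField (φ : C ⟶ D) [IsCover φ] :
    FiniteDimensional D.functionField (SourceField φ) := by
  have hsep : Algebra.IsSeparable D.functionField (SourceField φ) := IsCover.separable
  obtain ⟨U, hU, hηU, _⟩ := exists_isAffineOpen_mem_and_subset
    (U := (⊤ : C.scheme.Opens)) (x := genericPoint C.scheme) trivial
  obtain ⟨T, _, _, hT⟩ := exists_generators C.obj hU hηU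
  let T' : Set (SourceField φ) := (T : Set C.scheme.functionField)
  let M : IntermediateField D.functionField (SourceField φ) :=
    IntermediateField.adjoin D.functionField T'
  let S : Subring C.scheme.functionField := M.toSubfield.toSubring
  have hbase : (baseHom C.obj).range ≤ S := by
    rintro _ ⟨a, rfl⟩
    rw [baseHom_eq_comp φ IsCover.nonconstant]
    exact M.algebraMap_mem (baseHom D.obj a)
  have hTS : (T : Set C.scheme.functionField) ⊆ S := fun t ht =>
    IntermediateField.subset_adjoin D.functionField T' ht
  have hM : M = ⊤ := by
    refine top_le_iff.1 fun z _ => ?_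
    have hmem := hT S hbase hTS
    have : Nonempty U := ⟨⟨_, hηU⟩⟩
    have := functionField_isFractionRing_of_isAffineOpen C.scheme U hU
    obtain ⟨s, t, _, hst⟩ := IsFractionRing.div_surjective (A := Γ(C.scheme, U))
      (K := C.scheme.functionField) z
    rw [← hst]
    exact M.div_mem (hmem s) (hmem t)
  have : Finite T' := T.finite_toSet
  have : FiniteDimensional D.functionField M :=
    IntermediateField.finiteDimensional_adjoin fun x _ =>
      (Algebra.IsSeparable.isIntegral D.functionField x)
  rw [hM] at this
  exact .of_finrank_pos (by
    rw [← IntermediateField.finrank_top']; exact Module.finrank_pos)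

variable {K : Type u} [Field K] {C D : Curve K}

lemma Curve.isPrincipalIdealRing_stalk (C : Curve K) (x : C.scheme)
    [IsNoetherianRing (C.scheme.presheaf.stalk x)] :
    IsPrincipalIdealRing (C.scheme.presheaf.stalk x) := by
  have := C.valuationRing_stalk x
  exact ((tfae_of_isNoetherianRing_of_isLocalRing_of_isDomain _).out 1 0).1 this

/-- Every field between `K(D)` and `K(C)` is the function field of a curve through which the cover
factors. -/
theorem exists_curve_of_intermediateField (φ : C ⟶ D) [IsCover φ]
    (M : IntermediateField D.functionField (SourceField φ)) :
    ∃ (E : Curve K) (ψ : C ⟶ E) (hψ : Nonconstant ψ),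
      Set.range (functionFieldMap ψ hψ) = (M : Set (SourceField φ)) := by
  have hsep : Algebra.IsSeparable D.functionField (SourceField φ) := IsCover.separable
  have hnoeth : IsLocallyNoetherian D.scheme := by
    have : IsLocallyNoetherian (Spec (CommRingCat.of K)) := inferInstance
    exact LocallyOfFiniteType.isLocallyNoetherian D.obj.hom
  obtain ⟨B, hB, g, τ, hg, hBpir, hτ, hτg⟩ := exists_normalization (X := D.scheme)
    (fun x => D.isPrincipalIdealRing_stalk x) M
  let val : CommRingCat.of M ⟶ C.scheme.presheaf.stalk (genericPoint C.scheme) :=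
    CommRingCat.ofHom M.val.toRingHom
  let α : D.scheme.presheaf.stalk (genericPoint D.scheme) ⟶ CommRingCat.of M :=
    CommRingCat.ofHom (algebraMap D.functionField M)
  have hα : Spec.map τ ≫ genericInclusion B ≫ g = Spec.map α ≫ genericInclusion D.scheme := hτg
  have hφ : Spec.map (α ≫ val) ≫ genericInclusion D.scheme =
      genericInclusion C.scheme ≫ schemeHom φ := SpecMap_functionFieldMap φ IsCover.nonconstant
  have hBsep : B.IsSeparated := by
    constructor
    rw [← Limits.terminal.comp_from g]
    infer_instance
  -- The inclusion of M into K(C) gives a morphism from the generic point of C to B over D, which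
  -- extends to C because B is finite over D.
  obtain ⟨f, hf, hf'⟩ := exists_hom_of_generic (schemeHom φ) g C.valuationRing_stalk
    (Spec.map val ≫ Spec.map τ ≫ genericInclusion B) (by
      rw [Category.assoc, Category.assoc, hα, ← hφ, Spec.map_comp, Category.assoc])
  have hgen : f (genericPoint C.scheme) = genericPoint B := by
    obtain ⟨p⟩ : Nonempty (Spec C.scheme.functionField) := inferInstance
    rw [← genericInclusion_apply p, ← Scheme.Hom.comp_apply, hf', Scheme.Hom.comp_apply,
      Scheme.Hom.comp_apply, genericInclusion_apply]
  have hfproper : IsProper f := by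
    have : IsProper (f ≫ g) := by rw [hf]; infer_instance
    exact IsProper.of_comp f g
  have hfsurj : Surjective f := ⟨surjective_of_map_genericPoint f hgen⟩
  have hgproper : IsProper (g ≫ D.obj.hom) := inferInstance
  have hval (b : B) : ValuationRing (B.presheaf.stalk b) := by
    have := hBpir b
    exact ((tfae_of_isNoetherianRing_of_isLocalRing_of_isDomain _).out 0 1).1 this
  -- If B were a single point, φ would be constant. The point b is what forces B to have dimension
  -- one.
  obtain ⟨b, hb⟩ : ∃ b : B, b ≠ genericPoint B := by
    by_contra! h
    obtain ⟨x, y, hxy⟩ := IsCover.nonconstant (φ := φ)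
    apply hxy
    rw [← hf, Scheme.Hom.comp_apply, Scheme.Hom.comp_apply, h (f x), h (f y)]
  have hfirr : GeometricallyIrreducible (f ≫ g ≫ D.obj.hom) := by
    rw [← Category.assoc, hf, schemeHom_comp_hom]
    exact C.property.geometricallyIrreducible
  have hcurve : IsCurve (Over.mk (g ≫ D.obj.hom)) :=
    { isIntegral := hB
      projective := by
        have : IsIntegral (Over.mk (g ≫ D.obj.hom)).left := hB
        have : IsProper (Over.mk (g ≫ D.obj.hom)).hom := hgproper
        exact isProjectiveOver_of_isProper _ hval
      geometricallyIrreducible := geometricallyIrreducible_of_surjective f (g ≫ D.obj.hom)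
      dim_eq_one := topologicalKrullDim_eq_one (X := B) hBpir hb
      nonsingular := fun x => by
        have : IsPrincipalIdealRing (B.presheaf.stalk x) := hBpir x
        exact (inferInstance : IsRegularLocalRing (B.presheaf.stalk x)) }
  let E : Curve K := ⟨Over.mk (g ≫ D.obj.hom), hcurve⟩
  let ψ : C ⟶ E := InducedCategory.homMk (Over.homMk f (by
    change f ≫ g ≫ D.obj.hom = _
    rw [← Category.assoc, hf, schemeHom_comp_hom]))
  have hψ : Nonconstant ψ := nonconstant_of_map_genericPoint hgen
  let σ : E.functionField →+* C.functionField := (τ ≫ val).hom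
  have hσ : functionFieldMap ψ hψ = σ := by
    rw [functionFieldMap_eq_iff]
    change Spec.map (τ ≫ val) ≫ genericInclusion B = genericInclusion C.scheme ≫ f
    rw [hf', Spec.map_comp, Category.assoc]
  refine ⟨E, ψ, hψ, ?_⟩
  rw [hσ]
  ext z
  constructor
  · rintro ⟨y, rfl⟩
    exact (τ y).2
  · intro hz
    obtain ⟨y, hy⟩ := hτ.2 ⟨z, hz⟩
    exact ⟨y, congrArg Subtype.val hy⟩

variable {K : Type u} [Field K] {C D E B : Curve K}

/-! ### Factoring covers through function fields -/

lemma subfieldMap_injective {F L : Type*} [Field F] [Field L] (f : F →+* L) :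
    Function.Injective (Subfield.map f) := fun s t h => by
  rw [← Subfield.comap_map f s, h, Subfield.comap_map]

lemma subfieldMap_lt_iff {F L : Type*} [Field F] [Field L] (f : F →+* L) {s t : Subfield F} :
    Subfield.map f s < Subfield.map f t ↔ s < t := by
  have hle (s t : Subfield F) : Subfield.map f s ≤ Subfield.map f t ↔ s ≤ t := by
    rw [Subfield.map_le_iff_le_comap, Subfield.comap_map]
  rw [lt_iff_le_not_ge, lt_iff_le_not_ge, hle, hle]

lemma getLast_le_of_pairwise {α : Type*} [Preorder α] {l : List α} (h : l.Pairwise (· > ·))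
    {x y : α}
    (hx : l.getLast? = some x) (hy : y ∈ l) : x ≤ y := by
  induction l with
  | nil => simp at hy
  | cons a l ih =>
    rw [List.pairwise_cons] at h
    cases l with
    | nil => simp_all
    | cons b l =>
      rw [List.getLast?_cons_cons] at hx
      rcases List.mem_cons.1 hy with rfl | hy
      · exact (h.1 x (List.mem_of_getLast? hx)).le
      · exact ih h.2 hx hy

lemma Nonconstant.cancel {α : C ⟶ D} (hα : Nonconstant α) {β γ : D ⟶ E} (hβ : Nonconstant β)
    (hγ : Nonconstant γ) (h : α ≫ β = α ≫ γ) : β = γ := by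
  apply hom_ext_of_functionFieldMap hβ hγ
  have h1 : (functionFieldMap α hα).comp (functionFieldMap β hβ) =
      (functionFieldMap α hα).comp (functionFieldMap γ hγ) := by
    rw [← functionFieldMap_comp hα hβ (hα.comp hβ), ← functionFieldMap_comp hα hγ (hα.comp hγ)]
    congr 1
  exact RingHom.ext fun x => (functionFieldMap α hα).injective (congr($h1 x))

/-- Containment of images yields a homomorphism K(D) → K(E). It is over the base field by
`IsOverBase.of_comp`, and hence comes from a morphism. -/
lemma exists_factorization {α : C ⟶ E} (hα : Nonconstant α) {β : C ⟶ D} (hβ : Nonconstant β)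
    (h : (functionFieldMap β hβ).fieldRange ≤ (functionFieldMap α hα).fieldRange) :
    ∃ γ : E ⟶ D, Nonconstant γ ∧ α ≫ γ = β := by
  choose τ hτ using fun x => h ⟨x, rfl⟩
  let τ' : D.functionField →+* E.functionField :=
    { toFun := τ
      map_one' := (functionFieldMap α hα).injective (by rw [hτ, map_one, map_one])
      map_zero' := (functionFieldMap α hα).injective (by rw [hτ, map_zero, map_zero])
      map_mul' := fun x y => (functionFieldMap α hα).injective (by simp only [hτ, map_mul])
      map_add' := fun x y => (functionFieldMap α hα).injective (by simp only [hτ, map_add]) }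
  have hτ' : (functionFieldMap α hα).comp τ' = functionFieldMap β hβ := RingHom.ext hτ
  obtain ⟨γ, hγ, hγτ⟩ := exists_hom_of_functionField τ'
    ((isOverBase_functionFieldMap α hα).of_comp (hτ' ▸ isOverBase_functionFieldMap β hβ))
  refine ⟨γ, hγ, hom_ext_of_functionFieldMap (hα.comp hγ) hβ ?_⟩
  rw [functionFieldMap_comp hα hγ, hγτ, hτ']

lemma exists_iso_of_fieldRange_eq {α : C ⟶ E} (hα : Nonconstant α) {β : C ⟶ B}
    (hβ : Nonconstant β)
    (h : (functionFieldMap α hα).fieldRange = (functionFieldMap β hβ).fieldRange) :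
    ∃ ρ : E ≅ B, β = α ≫ ρ.hom := by
  obtain ⟨γ, hγ, hγ'⟩ := exists_factorization hα hβ h.ge
  obtain ⟨δ, hδ, hδ'⟩ := exists_factorization hβ hα h.le
  refine ⟨⟨γ, δ, ?_, ?_⟩, hγ'.symm⟩
  · exact hα.cancel (hγ.comp hδ) (nonconstant_hom (Iso.refl E))
      (by rw [← Category.assoc, hγ', hδ', Category.comp_id])
  · exact hβ.cancel (hδ.comp hγ) (nonconstant_hom (Iso.refl B))
      (by rw [← Category.assoc, hδ', hγ', Category.comp_id])

lemma isCover_of_comp {α : C ⟶ E} (hα : Nonconstant α) {β : E ⟶ D} (hβ : Nonconstant β)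
    [hαβ : IsCover (α ≫ β)] : IsCover α ∧ IsCover β := by
  let := (functionFieldMap α hα).toAlgebra
  let := (functionFieldMap β hβ).toAlgebra
  let := (functionFieldMap (α ≫ β) hαβ.nonconstant).toAlgebra
  have : IsScalarTower D.functionField E.functionField C.functionField :=
    .of_algebraMap_eq' (functionFieldMap_comp hα hβ _)
  have := hαβ.separable
  exact ⟨⟨hα, Algebra.isSeparable_tower_top_of_isSeparable D.functionField E.functionField
    C.functionField⟩, ⟨hβ, Algebra.isSeparable_tower_bot_of_isSeparable D.functionField
    E.functionField C.functionField⟩⟩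

/-- The homomorphism of function fields attached to a cover. -/
noncomputable abbrev coverMap (φ : C ⟶ D) [IsCover φ] : D.functionField →+* C.functionField :=
  functionFieldMap φ IsCover.nonconstant

/-- Inside K(C) the degree becomes a relative degree of subfields, which does not change under
further embeddings of K(C). -/
lemma degree_eq_relfinrank (φ : C ⟶ D) [IsCover φ] :
    degree φ = Subfield.relfinrank (coverMap φ).fieldRange ⊤ := by
  rw [Subfield.relfinrank_top_right, degree]
  exact Algebra.finrank_eq_of_equiv_equiv
    (RingEquiv.ofBijective (coverMap φ).rangeRestrictField
      ⟨(coverMap φ).rangeRestrictField.injective, (coverMap φ).rangeRestrictField_bijective.2⟩)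
    (RingEquiv.refl _) rfl

lemma two_le_degree_iff (φ : C ⟶ D) [IsCover φ] :
    2 ≤ degree φ ↔ (coverMap φ).fieldRange < ⊤ := by
  have hpos : 0 < degree φ := Module.finrank_pos
  have h1 : degree φ = 1 ↔ (coverMap φ).fieldRange = ⊤ := by
    rw [degree_eq_relfinrank, Subfield.relfinrank_eq_one_iff, top_le_iff]
  rw [lt_top_iff_ne_top, ne_eq, ← h1]
  omega

/-! ### The chain of subfields as a complete invariant of decompositions -/

namespace CoverSeq

lemma nonconstant_comp (d : CoverSeq D C) : Nonconstant d.comp := by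
  induction d with
  | single φ₁ h => exact IsCover.nonconstant (φ := φ₁)
  | cons φ₁ h d ih => exact Nonconstant.comp IsCover.nonconstant ih

/-- The decreasing list `[K(C), …, K(D)]` of subfields of `K(C)` attached to a sequence of
covers. -/
noncomputable def fields : {C : Curve K} → CoverSeq D C → List (Subfield C.functionField)
  | _, single φ₁ _ => [⊤, (coverMap φ₁).fieldRange]
  | _, cons φ₁ _ d => ⊤ :: d.fields.map (Subfield.map (coverMap φ₁))

lemma exists_fields_eq (d : CoverSeq D C) : ∃ M l, d.fields = ⊤ :: M :: l := by
  induction d with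
  | single φ₁ h => exact ⟨_, _, rfl⟩
  | cons φ₁ h d ih =>
    obtain ⟨M, l, hl⟩ := ih
    exact ⟨_, _, by rw [fields, hl]; rfl⟩

lemma getLast?_fields (d : CoverSeq D C) :
    d.fields.getLast? = some (functionFieldMap d.comp d.nonconstant_comp).fieldRange := by
  induction d with
  | single φ₁ h => rfl
  | cons φ₁ h d ih =>
    obtain ⟨M, l, hl⟩ := d.exists_fields_eq
    have h1 := functionFieldMap_comp (IsCover.nonconstant (φ := φ₁)) d.nonconstant_comp
      (cons φ₁ h d).nonconstant_comp
    have h2 : (cons φ₁ h d).fields.getLast? =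
        (d.fields.map (Subfield.map (coverMap φ₁))).getLast? := by
      rw [fields, hl]; rfl
    rw [h2, List.getLast?_map, ih, Option.map_some, RingHom.map_fieldRange]
    exact congrArg (fun σ => some (RingHom.fieldRange σ)) h1.symm

lemma isChain_fields (d : CoverSeq D C) : d.fields.IsChain (· > ·) := by
  induction d with
  | single φ₁ h => simpa [fields] using (two_le_degree_iff φ₁).1 h
  | cons φ₁ h d ih =>
    obtain ⟨M, l, hl⟩ := d.exists_fields_eq
    have h1 : (d.fields.map (Subfield.map (coverMap φ₁))).IsChain (· > ·) := by
      rw [List.isChain_map]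
      exact ih.imp fun _ _ h => (subfieldMap_lt_iff _).2 h
    rw [fields]
    rw [hl, List.map_cons] at h1 ⊢
    refine List.isChain_cons_cons.2 ⟨?_, h1⟩
    rw [← RingHom.fieldRange_eq_map]
    exact (two_le_degree_iff φ₁).1 h

lemma degrees_eq_zipWith (d : CoverSeq D C) :
    d.degrees = List.zipWith (fun M N => Subfield.relfinrank N M) d.fields d.fields.tail := by
  induction d with
  | single φ₁ h => simp [degrees, fields, degree_eq_relfinrank]
  | cons φ₁ h d ih =>
    obtain ⟨M, l, hl⟩ := d.exists_fields_eq
    rw [degrees, ih, fields, hl, degree_eq_relfinrank, RingHom.fieldRange_eq_map]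
    have key (a b : List (Subfield _)) :
        List.zipWith (fun M N => Subfield.relfinrank N M) (a.map (Subfield.map (coverMap φ₁)))
          (b.map (Subfield.map (coverMap φ₁))) =
        List.zipWith (fun M N => Subfield.relfinrank N M) a b := by
      simp only [List.zipWith_map, Subfield.relfinrank_map_map]
    exact congrArg (_ :: ·) (key (⊤ :: M :: l) (M :: l)).symm

lemma EquivOver.fields_eq {ρ : C ≅ B} {d : CoverSeq D C} {e : CoverSeq D B}
    (h : EquivOver ρ d e) :
    d.fields = e.fields.map (Subfield.map (functionFieldMap ρ.hom (nonconstant_hom ρ))) := by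
  have hsurj {C B : Curve K} (ρ : C ≅ B) :
      (functionFieldMap ρ.hom (nonconstant_hom ρ)).fieldRange = ⊤ := by
    rw [RingHom.fieldRange_eq_top_iff]
    intro x
    have h1 := functionFieldMap_comp (nonconstant_hom ρ) (nonconstant_hom ρ.symm)
      ((nonconstant_hom ρ).comp (nonconstant_hom ρ.symm))
    have h2 : functionFieldMap (ρ.hom ≫ ρ.symm.hom)
        ((nonconstant_hom ρ).comp (nonconstant_hom ρ.symm)) = RingHom.id _ := by
      rw [← functionFieldMap_id (nonconstant_hom (Iso.refl C))]
      congr 1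
      simp
    exact ⟨_, (congr($h1 x)).symm.trans congr($h2 x)⟩
  induction h with
  | single ρ φ₁ ψ₁ hφ hψ comm =>
    have h1 := functionFieldMap_comp (nonconstant_hom ρ) (IsCover.nonconstant (φ := ψ₁))
      ((nonconstant_hom ρ).comp IsCover.nonconstant)
    have h2 : coverMap φ₁ = functionFieldMap (ρ.hom ≫ ψ₁)
        ((nonconstant_hom ρ).comp IsCover.nonconstant) := by congr 1; exact comm.symm
    simp [fields, ← RingHom.fieldRange_eq_map, hsurj, RingHom.map_fieldRange, h2, h1]
  | cons ρ ρ₁ φ₁ ψ₁ hφ hψ d e comm h ih =>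
    have h1 := functionFieldMap_comp (nonconstant_hom ρ) (IsCover.nonconstant (φ := ψ₁))
      ((nonconstant_hom ρ).comp IsCover.nonconstant)
    have h3 := functionFieldMap_comp (IsCover.nonconstant (φ := φ₁)) (nonconstant_hom ρ₁)
      (Nonconstant.comp IsCover.nonconstant (nonconstant_hom ρ₁))
    have h2 : functionFieldMap (φ₁ ≫ ρ₁.hom)
        (Nonconstant.comp IsCover.nonconstant (nonconstant_hom ρ₁)) =
        functionFieldMap (ρ.hom ≫ ψ₁) ((nonconstant_hom ρ).comp IsCover.nonconstant) := by
      congr 1; exact comm.symm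
    rw [h1, h3] at h2
    rw [fields, fields, ih, List.map_cons, List.map_map, List.map_map,
      ← RingHom.fieldRange_eq_map, hsurj]
    congr 2
    ext1 s
    simp only [Function.comp_apply, Subfield.map_map]
    rw [h2]

/-- The second entries are the images of K(C_1) and K(B_1), so their agreement produces ρ_1.
Pushforward of subfields is injective, which lets the induction continue with the tails. The
hypothesis on compositions makes the last isomorphism the identity. -/
lemma equivOver_of_fields_eq {ρ : C ≅ B} {d : CoverSeq D C} {e : CoverSeq D B}
    (hcomp : ρ.hom ≫ e.comp = d.comp)
    (h : d.fields = e.fields.map (Subfield.map (functionFieldMap ρ.hom (nonconstant_hom ρ)))) :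
    EquivOver ρ d e := by
  induction d generalizing B e with
  | single φ₁ hφ =>
    cases e with
    | single ψ₁ hψ => exact .single _ _ _ _ _ hcomp
    | cons ψ₁ hψ e =>
      obtain ⟨M, l, hl⟩ := e.exists_fields_eq
      simp [fields, hl] at h
  | cons φ₁ hφ d ih =>
    obtain ⟨M, l, hl⟩ := d.exists_fields_eq
    cases e with
    | single ψ₁ hψ => simp [fields, hl] at h
    | cons ψ₁ hψ e =>
      obtain ⟨N, m, hm⟩ := e.exists_fields_eq
      have h0 := (List.cons_eq_cons.1 h).2
      have h1 := functionFieldMap_comp (nonconstant_hom ρ) (IsCover.nonconstant (φ := ψ₁))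
        ((nonconstant_hom ρ).comp IsCover.nonconstant)
      have hr : (coverMap φ₁).fieldRange = (functionFieldMap (ρ.hom ≫ ψ₁)
          ((nonconstant_hom ρ).comp IsCover.nonconstant)).fieldRange := by
        rw [h1, ← RingHom.map_fieldRange, RingHom.fieldRange_eq_map, RingHom.fieldRange_eq_map]
        rw [hl, hm] at h0
        exact (List.cons_eq_cons.1 h0).1
      obtain ⟨ρ₁, hρ₁⟩ := exists_iso_of_fieldRange_eq _ _ hr
      have h3 := functionFieldMap_comp (IsCover.nonconstant (φ := φ₁)) (nonconstant_hom ρ₁)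
        (Nonconstant.comp IsCover.nonconstant (nonconstant_hom ρ₁))
      have h2 : functionFieldMap (φ₁ ≫ ρ₁.hom)
          (Nonconstant.comp IsCover.nonconstant (nonconstant_hom ρ₁)) =
          functionFieldMap (ρ.hom ≫ ψ₁) ((nonconstant_hom ρ).comp IsCover.nonconstant) := by
        congr 1; exact hρ₁.symm
      rw [h1, h3] at h2
      refine .cons ρ ρ₁ φ₁ ψ₁ hφ hψ d e hρ₁ (ih ?_ ?_)
      · refine Nonconstant.cancel (α := φ₁) IsCover.nonconstant
          ((nonconstant_hom ρ₁).comp e.nonconstant_comp) d.nonconstant_comp ?_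
        rw [← Category.assoc, ← hρ₁, Category.assoc]
        exact hcomp
      · apply List.map_injective_iff.2 (subfieldMap_injective (coverMap φ₁))
        rw [h0, List.map_map, List.map_map]
        congr 1
        ext1 s
        simp only [Function.comp_apply, Subfield.map_map]
        rw [h2]

/-- Realise the largest proper subfield M by a curve E under C, factor φ through E, pull the
remaining subfields back to K(E), and induct on the length. -/
lemma exists_of_isChain (φ : C ⟶ D) [IsCover φ] (M : Subfield C.functionField)
    (l : List (Subfield C.functionField)) (hl : (⊤ :: M :: l).IsChain (· > ·))
    (hlast : (M :: l).getLast? = some (coverMap φ).fieldRange) :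
    ∃ d : CoverSeq D C, d.comp = φ ∧ d.fields = ⊤ :: M :: l := by
  induction hn : l.length generalizing C M l with
  | zero =>
    obtain rfl := List.length_eq_zero_iff.1 hn
    obtain rfl : M = (coverMap φ).fieldRange := by simpa using hlast
    exact ⟨single φ ((two_le_degree_iff φ).2 (by simpa using hl)), rfl, rfl⟩
  | succ n ih =>
    obtain ⟨N, l, rfl⟩ := List.exists_cons_of_length_eq_add_one hn
    have hle : ∀ S ∈ M :: N :: l, (coverMap φ).fieldRange ≤ S := by
      have h1 := List.mem_of_getLast? hlast
      have h2 := (List.isChain_iff_pairwise.1 hl).tail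
      rw [List.tail_cons] at h2
      intro S hS
      exact getLast_le_of_pairwise h2 hlast hS
    obtain ⟨E, ψ, hψ, hψM⟩ := exists_curve_of_intermediateField φ
      { M with algebraMap_mem' := fun x => hle M List.mem_cons_self ⟨x, rfl⟩ }
    have hM : (functionFieldMap ψ hψ).fieldRange = M := SetLike.coe_injective hψM
    obtain ⟨γ, hγ, rfl⟩ := exists_factorization hψ (IsCover.nonconstant (φ := φ))
      ((hle M List.mem_cons_self).trans hM.ge)
    obtain ⟨hψc, hγc⟩ := isCover_of_comp hψ hγ
    have hleM : ∀ S ∈ N :: l, S ≤ M := by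
      have h2 := (List.isChain_iff_pairwise.1 hl).tail
      rw [List.tail_cons, List.pairwise_cons] at h2
      exact fun S hS => (h2.1 S hS).le
    let f := Subfield.map (coverMap ψ)
    obtain ⟨l', hl'⟩ : ∃ l', List.map f l' = N :: l := by
      refine ⟨(N :: l).map (Subfield.comap (coverMap ψ)), ?_⟩
      rw [List.map_map]
      conv_rhs => rw [← List.map_id (N :: l)]
      exact List.map_congr_left fun S hS =>
        Subfield.map_comap_eq_self ((hleM S hS).trans hM.ge)
    have hfM : f ⊤ = M := by rw [← hM]; exact (RingHom.fieldRange_eq_map _).symm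
    obtain ⟨N', l'', rfl⟩ : ∃ N' l'', l' = N' :: l'' := by
      cases l' with
      | nil => simp at hl'
      | cons a b => exact ⟨a, b, rfl⟩
    rw [List.isChain_cons_cons] at hl
    have hMtop : M < ⊤ := hl.1
    have hcomp := functionFieldMap_comp hψ hγ (hψ.comp hγ)
    obtain ⟨d, hd, hd'⟩ := ih γ N' l'' (by
        rw [← hfM, ← hl', ← List.map_cons, List.isChain_map] at hl
        exact hl.2.imp fun _ _ h => (subfieldMap_lt_iff _).1 h) (by
        rw [List.getLast?_cons_cons, ← hl', List.getLast?_map] at hlast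
        apply Option.map_injective (subfieldMap_injective (coverMap ψ))
        rw [hlast, Option.map_some, RingHom.map_fieldRange]
        exact congrArg (fun σ => some (RingHom.fieldRange σ)) hcomp)
      (by have := congrArg List.length hl'; simp at this hn; omega)
    refine ⟨cons ψ ((two_le_degree_iff ψ).2 (hM.trans_lt hMtop)) d, ?_, ?_⟩
    · rw [comp, hd]
    · rw [fields, hd', List.map_cons]
      change _ :: f ⊤ :: _ = _
      rw [hfM, hl']

end CoverSeq

/-! ### Chains and lists -/

section Chains

variable {α β : Type*}

lemma IncreasingChain.ext_of_ofFn [Preorder α] {a b : α} {c c' : IncreasingChain a b}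
    (h : List.ofFn c.obj = List.ofFn c'.obj) : c = c' := by
  obtain ⟨n, hn, f, _, _, _⟩ := c
  obtain ⟨n', hn', f', _, _, _⟩ := c'
  have h1 := List.ofFn_inj'.1 h
  obtain ⟨h2, h3⟩ := Sigma.mk.inj_iff.1 h1
  obtain rfl : n = n' := Nat.succ_injective h2
  obtain rfl := eq_of_heq h3
  rfl

lemma exists_increasingChain [Preorder α] {a b M : α} {t : List α}
    (h : (b :: M :: t).IsChain (· > ·)) (ha : (b :: M :: t).getLast? = some a) :
    ∃ c : IncreasingChain a b, List.ofFn c.obj = (b :: M :: t).reverse := by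
  obtain ⟨l, hl⟩ : ∃ l, l = (b :: M :: t).reverse := ⟨_, rfl⟩
  have hlen : l.length = t.length + 1 + 1 := by simp [hl]
  have hpw : l.Pairwise (· < ·) := by
    rw [hl, List.pairwise_reverse]
    exact List.isChain_iff_pairwise.1 h
  have hfirst : l.head? = some a := by rw [hl, List.head?_reverse, ha]
  have hlast : l.getLast? = some b := by rw [hl, List.getLast?_reverse]; rfl
  rw [← hl]
  refine ⟨⟨t.length + 1, Nat.succ_pos _, fun i => l.get (i.cast hlen.symm), ?_, ?_, ?_⟩, ?_⟩
  · intro i j hij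
    exact List.pairwise_iff_get.1 hpw _ _ hij
  · rw [List.head?_eq_getElem?, List.getElem?_eq_some_iff] at hfirst
    exact hfirst.2
  · rw [List.getLast?_eq_getElem?, List.getElem?_eq_some_iff] at hlast
    obtain ⟨h1, h2⟩ := hlast
    rw [← h2]
    simp [hlen]
  · refine List.ext_getElem (by simp [hlen]) fun i h1 h2 => ?_
    rw [List.getElem_ofFn]
    rfl

lemma IncreasingChain.exists_reverse_ofFn_eq [Preorder α] {a b : α} (c : IncreasingChain a b) :
    ∃ M t, (List.ofFn c.obj).reverse = b :: M :: t ∧ (b :: M :: t).IsChain (· > ·) ∧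
      (M :: t).getLast? = some a := by
  obtain ⟨l, hl⟩ : ∃ l, l = (List.ofFn c.obj).reverse := ⟨_, rfl⟩
  have hlen : l.length = c.length + 1 := by simp [hl]
  have hpw : l.Pairwise (· > ·) := by
    rw [hl, List.pairwise_reverse, List.pairwise_ofFn]
    exact fun i j hij => c.strictMono hij
  have hfirst : l.head? = some b := by
    rw [hl, List.head?_reverse, List.getLast?_eq_getElem?, List.getElem?_eq_some_iff]
    refine ⟨by simp, ?_⟩
    rw [List.getElem_ofFn]
    refine Eq.trans (congrArg c.obj ?_) c.obj_last
    ext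
    simp
  have hlast : l.getLast? = some a := by
    rw [hl, List.getLast?_reverse, List.head?_eq_getElem?, List.getElem?_eq_some_iff]
    simpa using c.obj_zero
  have hpos := c.length_pos
  match l, hl, hlen, hpw, hfirst, hlast with
  | x :: M :: t, hl, hlen, hpw, hfirst, hlast =>
    obtain rfl : x = b := by simpa using hfirst
    exact ⟨M, t, hl.symm, List.isChain_iff_pairwise.2 hpw, by
      rwa [List.getLast?_cons_cons] at hlast⟩
  | [x], _, hlen, _, _, _ => simp at hlen; omega
  | [], _, hlen, _, _, _ => simp at hlen

/-- This passes from degrees indexed by the steps of an increasing chain to degrees computed from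
the decreasing list of subfields of a decomposition. -/
lemma ofFn_consecutive_eq (R : α → α → β) {n : ℕ} (f : Fin (n + 1) → α) {l : List α}
    (h : List.ofFn f = l.reverse) :
    List.ofFn (fun i : Fin n => R (f i.castSucc) (f i.succ)) =
      (List.zipWith (fun M N => R N M) l l.tail).reverse := by
  obtain rfl : l = (List.ofFn f).reverse := by rw [h, List.reverse_reverse]
  refine List.ext_getElem (by simp) fun i h1 h2 => ?_
  simp only [List.getElem_ofFn, List.getElem_reverse, List.getElem_zipWith, List.getElem_tail,
    List.length_zipWith, List.length_reverse, List.length_ofFn, List.length_tail]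
  simp only [List.length_ofFn] at h1
  congr 2 <;> ext <;> simp <;> omega

lemma IncreasingChain.mem_Icc [Preorder α] {a b : α} (c : IncreasingChain a b) (i) :
    c.obj i ∈ Set.Icc a b :=
  ⟨c.obj_zero.ge.trans (c.strictMono.monotone (Fin.zero_le _)),
    (c.strictMono.monotone (Fin.le_last _)).trans c.obj_last.le⟩

/-- Strictly increasing mutually inverse maps between two intervals give a bijection of chains. -/
def IncreasingChain.congr [PartialOrder α] [PartialOrder β] {a b : α} {a' b' : β} (f : α → β)
    (g : β → α) (hf : StrictMonoOn f (Set.Icc a b)) (hg : StrictMonoOn g (Set.Icc a' b'))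
    (fa : f a = a') (fb : f b = b') (hgf : ∀ x ∈ Set.Icc a b, g (f x) = x)
    (hfg : ∀ y ∈ Set.Icc a' b', f (g y) = y) (hab : a ≤ b) :
    IncreasingChain a b ≃ IncreasingChain a' b' :=
  { toFun := fun c => ⟨c.length, c.length_pos, fun i => f (c.obj i),
      fun _ _ hij => hf (c.mem_Icc _) (c.mem_Icc _) (c.strictMono hij), by rw [c.obj_zero, fa],
      by rw [c.obj_last, fb]⟩
    invFun := fun c => ⟨c.length, c.length_pos, fun i => g (c.obj i),
      fun _ _ hij => hg (c.mem_Icc _) (c.mem_Icc _) (c.strictMono hij),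
      by rw [c.obj_zero, ← fa, hgf _ ⟨le_rfl, hab⟩],
      by rw [c.obj_last, ← fb, hgf _ ⟨hab, le_rfl⟩]⟩
    left_inv := fun c => IncreasingChain.ext_of_ofFn (by
      congr 1; exact funext fun i => hgf _ (c.mem_Icc i))
    right_inv := fun c => IncreasingChain.ext_of_ofFn (by
      congr 1; exact funext fun i => hfg _ (c.mem_Icc i)) }

/-- Increasing chains in the dual order are decreasing chains. -/
def IncreasingChain.toDualEquiv [Preorder α] {a b : α} :
    IncreasingChain (OrderDual.toDual a) (OrderDual.toDual b) ≃ DecreasingChain a b where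
  toFun c := ⟨c.length, c.length_pos, fun i => OrderDual.ofDual (c.obj i),
    fun _ _ hij => c.strictMono hij, c.obj_zero, c.obj_last⟩
  invFun c := ⟨c.length, c.length_pos, fun i => OrderDual.toDual (c.obj i),
    fun _ _ hij => c.strictAnti hij, c.obj_zero, c.obj_last⟩

end Chains

/-! ### Decompositions and chains of fields -/

section Decompositions

variable {K : Type u} [Field K] {C D : Curve K}

/-- The list `fields` is invariant by `EquivOver.fields_eq`, separates classes by
`equivOver_of_fields_eq`, and takes every allowed value by `exists_of_isChain`. -/
lemma exists_equiv_subfieldChain (φ : C ⟶ D) [IsCover φ] :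
    ∃ e : DecompositionClass φ ≃ IncreasingChain (coverMap φ).fieldRange ⊤,
      ∀ d : Decomposition φ, List.ofFn (e d.toClass).obj = d.1.fields.reverse := by
  have hc (d : Decomposition φ) : ∃ c : IncreasingChain (coverMap φ).fieldRange ⊤,
      List.ofFn c.obj = d.1.fields.reverse := by
    obtain ⟨d, rfl⟩ := d
    obtain ⟨M, t, h⟩ := d.exists_fields_eq
    have h1 := d.isChain_fields
    have h2 := d.getLast?_fields
    rw [h] at h1 h2 ⊢
    exact exists_increasingChain h1 h2
  choose c hc using hc
  have hequiv (d e : Decomposition φ) : c d = c e ↔ d ≈ e := by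
    have h1 : c d = c e ↔ d.1.fields = e.1.fields := by
      rw [← List.reverse_inj, ← hc, ← hc]
      exact ⟨fun h => by rw [h], IncreasingChain.ext_of_ofFn⟩
    have h2 : e.1.fields.map (Subfield.map (functionFieldMap (Iso.refl C).hom
        (nonconstant_hom (Iso.refl C)))) = e.1.fields := by
      conv_rhs => rw [← List.map_id e.1.fields]
      refine List.map_congr_left fun S _ => ?_
      have h3 : functionFieldMap (Iso.refl C).hom (nonconstant_hom (Iso.refl C)) =
        RingHom.id _ := functionFieldMap_id _
      rw [h3, id_eq]
      exact Subfield.ext fun x => by simp [Subfield.mem_map]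
    rw [h1]
    constructor
    · intro h
      refine CoverSeq.equivOver_of_fields_eq ?_ (h.trans h2.symm)
      rw [d.2, e.2]
      exact Category.id_comp φ
    · intro h
      exact (CoverSeq.EquivOver.fields_eq h).trans h2
  let F : DecompositionClass φ → IncreasingChain (coverMap φ).fieldRange ⊤ :=
    Quotient.lift c fun d e h => (hequiv d e).2 h
  have hF : Function.Bijective F := by
    constructor
    · rintro ⟨d⟩ ⟨e⟩ h
      exact Quotient.sound ((hequiv d e).1 h)
    · intro s
      obtain ⟨M, t, hs, hs1, hs2⟩ := s.exists_reverse_ofFn_eq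
      obtain ⟨d, hd, hd'⟩ := CoverSeq.exists_of_isChain φ M t hs1 hs2
      refine ⟨Decomposition.toClass ⟨d, hd⟩, IncreasingChain.ext_of_ofFn ?_⟩
      rw [← List.reverse_inj, hs, ← hd', ← List.reverse_reverse d.fields]
      exact congrArg List.reverse (hc ⟨d, hd⟩)
  exact ⟨Equiv.ofBijective F hF, hc⟩

lemma exists_equiv_intermediateFieldChain (φ : C ⟶ D) [IsCover φ] :
    ∃ e : DecompositionClass φ ≃
      IncreasingChain (⊥ : IntermediateField D.functionField (SourceField φ)) ⊤,
      ∀ d : Decomposition φ, (e d.toClass).fieldDegrees = d.1.degrees.reverse := by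
  obtain ⟨e, he⟩ := exists_equiv_subfieldChain φ
  let R : Subfield (SourceField φ) := (algebraMap D.functionField (SourceField φ)).fieldRange
  -- Adjunction makes f defined on all subfields; on those containing the image of K(D) it adds
  -- nothing.
  let f (M : Subfield (SourceField φ)) : IntermediateField D.functionField (SourceField φ) :=
    IntermediateField.adjoin D.functionField (M : Set (SourceField φ))
  have hgf (M) (hM : R ≤ M) : (f M).toSubfield = M := by
    let M' : IntermediateField D.functionField (SourceField φ) :=
      { M with algebraMap_mem' := fun x => hM ⟨x, rfl⟩ }
    refine le_antisymm ?_ (IntermediateField.subset_adjoin _ _)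
    have : f M ≤ M' := IntermediateField.adjoin_le_iff.2 fun x hx => hx
    exact this
  have hfg (N : IntermediateField D.functionField (SourceField φ)) : f N.toSubfield = N :=
    IntermediateField.adjoin_self _ _
  have hg : StrictMono (IntermediateField.toSubfield :
    IntermediateField D.functionField (SourceField φ) → _) := fun _ _ h => h
  let E : IncreasingChain R ⊤ ≃
      IncreasingChain (⊥ : IntermediateField D.functionField (SourceField φ)) ⊤ :=
    IncreasingChain.congr f IntermediateField.toSubfield
      (fun M hM N hN h => by
        have : (f M).toSubfield < (f N).toSubfield := by rwa [hgf M hM.1, hgf N hN.1]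
        exact this)
      (hg.strictMonoOn _)
      ((congrArg f IntermediateField.bot_toSubfield.symm).trans (hfg ⊥))
      (hfg ⊤)
      (fun M hM => hgf M hM.1) (fun N _ => hfg N) le_top
  refine ⟨e.trans E, fun d => ?_⟩
  rw [CoverSeq.degrees_eq_zipWith,
    ← ofFn_consecutive_eq (fun M N => Subfield.relfinrank M N) _ (he d)]
  refine congrArg List.ofFn (funext fun i => ?_)
  let c := e d.toClass
  have hR (j) : (f (c.obj j)).toSubfield = c.obj j :=
    hgf _ (c.mem_Icc j).1
  exact congrArg₂ Subfield.relfinrank (hR _) (hR _)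

end Decompositions

/-! ### Chains of fields and chains of groups -/

section Galois

variable {F L N : Type*} [Field F] [Field L] [Field N] [Algebra F L] [Algebra F N]
  [FiniteDimensional F N] [IsGalois F N] (y : L →ₐ[F] N)

lemma relIndex_fixingSubgroup {M M' : IntermediateField F N} (h : M ≤ M') :
    M'.fixingSubgroup.relIndex M.fixingSubgroup = IntermediateField.relfinrank M M' := by
  have h1 := Subgroup.relIndex_mul_index (IntermediateField.fixingSubgroup_le h)
  have h2 := IntermediateField.finrank_bot_mul_relfinrank h
  have h3 (M : IntermediateField F N) : Module.finrank F M = M.fixingSubgroup.index :=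
    IntermediateField.finrank_eq_fixingSubgroup_index _ M
  rw [h3, h3, ← h1, mul_comm] at h2
  exact (Nat.eq_of_mul_eq_mul_right (Nat.pos_of_ne_zero Subgroup.index_ne_zero_of_finite) h2).symm

/-- The Galois correspondence for chains of fields between `F` and `L`, where `L` is embedded in a
finite Galois extension of `F`. -/
lemma exists_equiv_subgroupChain {H : Subgroup Gal(N/F)} (hH : H = y.fieldRange.fixingSubgroup) :
    ∃ e : IncreasingChain (⊥ : IntermediateField F L) ⊤ ≃ DecreasingChain (⊤ : Subgroup Gal(N/F)) H,
      ∀ c, (e c).indices = c.fieldDegrees := by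
  let f (M : IntermediateField F L) : (Subgroup Gal(N/F))ᵒᵈ :=
    OrderDual.toDual (M.map y).fixingSubgroup
  let g (U : (Subgroup Gal(N/F))ᵒᵈ) : IntermediateField F L :=
    (IntermediateField.fixedField (OrderDual.ofDual U)).comap y
  have hgf (M) : g (f M) = M := by
    change ((IntermediateField.fixedField (M.map y).fixingSubgroup).comap y) = M
    rw [IsGalois.fixedField_fixingSubgroup]
    ext x
    change y x ∈ M.map y ↔ _
    simp
  have hfg (U : (Subgroup Gal(N/F))ᵒᵈ) (hU : H ≤ OrderDual.ofDual U) : f (g U) = U := by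
    -- The condition H ≤ U places the fixed field of U inside y(L), so pulling back to L loses
    -- nothing.
    have h1 : IntermediateField.fixedField (OrderDual.ofDual U) ≤ y.fieldRange := by
      rw [← IsGalois.fixedField_fixingSubgroup y.fieldRange, ← hH]
      exact IntermediateField.fixedField_le hU
    have h2 : (g U).map y = IntermediateField.fixedField (OrderDual.ofDual U) := by
      ext x
      constructor
      · rintro ⟨z, hz, rfl⟩
        exact hz
      · intro hx
        obtain ⟨z, rfl⟩ := h1 hx
        exact ⟨z, hx, rfl⟩
    change OrderDual.toDual ((g U).map y).fixingSubgroup = U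
    rw [h2, IntermediateField.fixingSubgroup_fixedField]
    rfl
  have hfmono : Monotone f := fun M M' h =>
    IntermediateField.fixingSubgroup_le (IntermediateField.map_mono y h)
  have hgmono : Monotone g := fun U U' h x hx => IntermediateField.fixedField_le h hx
  have hfinj : Function.Injective f := Function.LeftInverse.injective hgf
  let E : IncreasingChain (⊥ : IntermediateField F L) ⊤ ≃
      IncreasingChain (OrderDual.toDual ⊤) (OrderDual.toDual H) :=
    IncreasingChain.congr f g ((hfmono.strictMono_of_injective hfinj).strictMonoOn _)
      (fun U hU V hV h => (hgmono h.le).lt_of_ne fun h' => h.ne <| by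
        rw [← hfg U hU.2, h', hfg V hV.2])
      (by
        change OrderDual.toDual (IntermediateField.map y ⊥).fixingSubgroup = _
        rw [IntermediateField.map_bot, IntermediateField.fixingSubgroup_bot])
      (by
        change OrderDual.toDual (IntermediateField.map y ⊤).fixingSubgroup = _
        rw [hH, AlgHom.fieldRange_eq_map])
      (fun M _ => hgf M) (fun U hU => hfg U hU.2) bot_le
  refine ⟨E.trans IncreasingChain.toDualEquiv, fun c => congrArg List.ofFn (funext fun i => ?_)⟩
  refine Eq.trans (relIndex_fixingSubgroup (IntermediateField.map_mono y
    (c.strictMono.monotone i.castSucc_le_succ))) ?_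
  exact IntermediateField.relfinrank_map_map _ _ y

end Galois

/-! ### Intersecting with a subgroup A such that AH = G -/

section Permutable

variable {G : Type*} [Group G] {A H : Subgroup G}

lemma DecreasingChain.mem_Icc {α : Type*} [Preorder α] {a b : α} (c : DecreasingChain a b) (i) :
    c.obj i ∈ Set.Icc b a :=
  ⟨c.obj_last.ge.trans (c.strictAnti.antitone (Fin.le_last _)),
    (c.strictAnti.antitone (Fin.zero_le _)).trans c.obj_zero.le⟩

/-- Taking inverses turns one inclusion into the other. -/
lemma mul_comm_of_mul_subset {J H : Subgroup G} (h : (H : Set G) * J ⊆ (J : Set G) * H) :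
    (J : Set G) * (H : Set G) = (H : Set G) * (J : Set G) := by
  refine Set.Subset.antisymm ?_ h
  rintro _ ⟨j, hj, k, hk, rfl⟩
  obtain ⟨j', hj', k', hk', h'⟩ := h ⟨k⁻¹, H.inv_mem hk, j⁻¹, J.inv_mem hj, rfl⟩
  refine ⟨k'⁻¹, H.inv_mem hk', j'⁻¹, J.inv_mem hj', ?_⟩
  have := congrArg (·⁻¹) h'
  simpa using this

/-- Dedekind's modular law: if g = ah lies in U, then so does a, because H ≤ U. -/
lemma coe_inf_mul (hAH : (A : Set G) * (H : Set G) = Set.univ) {U : Subgroup G} (hU : H ≤ U) :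
    ((U ⊓ A : Subgroup G) : Set G) * (H : Set G) = U := by
  ext g
  constructor
  · rintro ⟨a, ha, h, hh, rfl⟩
    exact U.mul_mem ha.1 (hU hh)
  · intro hg
    obtain ⟨a, ha, h, hh, rfl⟩ : g ∈ (A : Set G) * (H : Set G) := hAH ▸ Set.mem_univ g
    exact ⟨a, ⟨(U.mul_mem_cancel_right (hU hh)).1 hg, ha⟩, h, hh, rfl⟩

lemma inf_mul_comm (hAH : (A : Set G) * (H : Set G) = Set.univ) {U : Subgroup G} (hU : H ≤ U) :
    ((U ⊓ A : Subgroup G) : Set G) * (H : Set G) = (H : Set G) * (U ⊓ A : Subgroup G) := by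
  apply mul_comm_of_mul_subset
  rw [coe_inf_mul hAH hU]
  rintro _ ⟨h, hh, a, ha, rfl⟩
  exact U.mul_mem (hU hh) ha.1

/-- When J and H permute, JHJH = JJHH = JH, so the product set is already a subgroup. -/
lemma coe_sup_eq_mul {J : Subgroup G} (h : (J : Set G) * (H : Set G) = (H : Set G) * (J : Set G)) :
    ((J ⊔ H : Subgroup G) : Set G) = (J : Set G) * (H : Set G) := by
  refine Set.Subset.antisymm ?_ ?_
  swap
  · rintro _ ⟨j, hj, k, hk, rfl⟩
    exact Subgroup.mul_mem _ (Subgroup.mem_sup_left hj) (Subgroup.mem_sup_right hk)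
  let S : Subgroup G :=
    { carrier := (J : Set G) * (H : Set G)
      one_mem' := ⟨1, J.one_mem, 1, H.one_mem, one_mul 1⟩
      mul_mem' := by
        intro a b ha hb
        have : a * b ∈ ((J : Set G) * (H : Set G)) * ((J : Set G) * (H : Set G)) :=
          Set.mul_mem_mul ha hb
        rwa [mul_assoc, ← mul_assoc (H : Set G), ← h, mul_assoc (J : Set G), coe_mul_coe,
          ← mul_assoc, coe_mul_coe] at this
      inv_mem' := by
        intro a ha
        rw [h]
        obtain ⟨j, hj, k, hk, rfl⟩ := ha
        exact ⟨k⁻¹, H.inv_mem hk, j⁻¹, J.inv_mem hj, (mul_inv_rev j k).symm⟩ }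
  have : J ⊔ H ≤ S := sup_le (fun j hj => ⟨j, hj, 1, H.one_mem, mul_one j⟩)
    (fun k hk => ⟨1, J.one_mem, k, hk, one_mul k⟩)
  exact this

/-- If jk lies in A, then k lies in H ∩ A, which is contained in J. -/
lemma sup_inf_eq {J : Subgroup G} (h : (J : Set G) * (H : Set G) = (H : Set G) * (J : Set G))
    (hJ : J ∈ Set.Icc (H ⊓ A) A) : (J ⊔ H) ⊓ A = J := by
  refine le_antisymm ?_ (le_inf le_sup_left hJ.2)
  rintro g ⟨hg, hgA⟩
  have hg' : g ∈ ((J ⊔ H : Subgroup G) : Set G) := hg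
  rw [coe_sup_eq_mul h] at hg'
  obtain ⟨j, hj, k, hk, rfl⟩ := hg'
  exact J.mul_mem hj (hJ.1 ⟨hk, (A.mul_mem_cancel_left (hJ.2 hj)).1 hgA⟩)

lemma inf_sup_eq (hAH : (A : Set G) * (H : Set G) = Set.univ) {U : Subgroup G} (hU : H ≤ U) :
    (U ⊓ A) ⊔ H = U :=
  SetLike.coe_injective ((coe_sup_eq_mul (inf_mul_comm hAH hU)).trans (coe_inf_mul hAH hU))

/-- Since G = AH and H ≤ U, the group A is transitive on G/U, and the stabilizer of the base coset
in A is A ∩ U. -/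
lemma relIndex_eq_index (hAH : (A : Set G) * (H : Set G) = Set.univ) {U : Subgroup G} (hU : H ≤ U) :
    U.relIndex A = U.index := by
  have : MulAction.IsPretransitive A (G ⧸ U) := by
    refine (MulAction.isPretransitive_iff_base ((1 : G) : G ⧸ U)).2 fun q => ?_
    obtain ⟨g, rfl⟩ := QuotientGroup.mk_surjective q
    obtain ⟨a, ha, h, hh, rfl⟩ : g ∈ (A : Set G) * (H : Set G) := hAH ▸ Set.mem_univ g
    refine ⟨⟨a, ha⟩, ?_⟩
    change ((a * 1 : G) : G ⧸ U) = ((a * h : G) : G ⧸ U)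
    rw [mul_one, QuotientGroup.eq]
    simpa using hU hh
  refine Eq.trans ?_ (MulAction.index_stabilizer_of_transitive A ((1 : G) : G ⧸ U))
  rw [Subgroup.relIndex]
  congr 1
  ext a
  change (a : G) ∈ U ↔ (((a : G) * 1 : G) : G ⧸ U) = ((1 : G) : G ⧸ U)
  rw [mul_one, eq_comm, QuotientGroup.eq]
  simp

lemma relIndex_inf_inf [Finite G] (hAH : (A : Set G) * (H : Set G) = Set.univ) {U V : Subgroup G}
    (hU : H ≤ U) (hUV : U ≤ V) : (U ⊓ A).relIndex (V ⊓ A) = U.relIndex V := by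
  have h1 := Subgroup.relIndex_mul_relIndex (U ⊓ A) (V ⊓ A) A (inf_le_inf_right A hUV) inf_le_right
  rw [Subgroup.inf_relIndex_right, Subgroup.inf_relIndex_right, relIndex_eq_index hAH hU,
    relIndex_eq_index hAH (hU.trans hUV), ← Subgroup.relIndex_mul_index hUV] at h1
  exact Nat.eq_of_mul_eq_mul_right (Nat.pos_of_ne_zero Subgroup.index_ne_zero_of_finite) h1

lemma DecreasingChain.ext_of_obj {α : Type*} [Preorder α] {a b : α} {n : ℕ} {hn hn'}
    {f f' : Fin (n + 1) → α} {h1 h2 h3 h1' h2' h3'} (h : f = f') :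
    (⟨n, hn, f, h1, h2, h3⟩ : DecreasingChain a b) = ⟨n, hn', f', h1', h2', h3'⟩ := by
  subst h; rfl

/-- If `A` and `H` are subgroups with `AH = G`, intersection with `A` is a bijection from the chains
between `G` and `H` to the chains between `A` and `H ∩ A` of groups which permute with `H`. -/
lemma exists_equiv_permutableChain [Finite G] (hAH : (A : Set G) * (H : Set G) = Set.univ) :
    ∃ e : DecreasingChain (⊤ : Subgroup G) H ≃ PermutableChain A H,
      ∀ c, (e c).1.indices = c.indices := by
  let e : DecreasingChain (⊤ : Subgroup G) H ≃ PermutableChain A H :=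
    { toFun := fun c => ⟨⟨c.length, c.length_pos, fun i => c.obj i ⊓ A,
        fun i j hij => (inf_le_inf_right A (c.strictAnti hij).le).lt_of_ne fun h =>
          (c.strictAnti hij).ne <| by
            rw [← inf_sup_eq hAH (c.mem_Icc j).1, h, inf_sup_eq hAH (c.mem_Icc i).1],
        by rw [c.obj_zero, top_inf_eq], by rw [c.obj_last]⟩,
        fun i => inf_mul_comm hAH (c.mem_Icc i).1⟩
      invFun := fun c => ⟨c.1.length, c.1.length_pos, fun i => c.1.obj i ⊔ H,
        fun i j hij => (sup_le_sup_right (c.1.strictAnti hij).le H).lt_of_ne fun h =>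
          (c.1.strictAnti hij).ne <| by
            rw [← sup_inf_eq (c.2 j) (c.1.mem_Icc j), h, sup_inf_eq (c.2 i) (c.1.mem_Icc i)],
        by
          have h0 := c.2 0
          rw [c.1.obj_zero] at h0 ⊢
          exact SetLike.coe_injective ((coe_sup_eq_mul h0).trans hAH),
        by rw [c.1.obj_last, sup_eq_right]; exact inf_le_left⟩
      left_inv := fun c => DecreasingChain.ext_of_obj
        (funext fun i => inf_sup_eq hAH (c.mem_Icc i).1)
      right_inv := fun c => Subtype.ext (DecreasingChain.ext_of_obj
        (funext fun i => sup_inf_eq (c.2 i) (c.1.mem_Icc i))) }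
  refine ⟨e, fun c => congrArg List.ofFn (funext fun i => ?_)⟩
  exact relIndex_inf_inf hAH (c.mem_Icc _).1 (c.strictAnti.antitone i.castSucc_le_succ)

end Permutable

/-! ### Stabilizers and transitive subgroups of the monodromy group -/

section Monodromy

variable {F L Ω : Type*} [Field F] [Field L] [Field Ω] [Algebra F L] [Algebra F Ω]

lemma stabilizer_eq_fixingSubgroup (x : L →ₐ[F] Ω) :
    MulAction.stabilizer (GaloisClosureGroup F L Ω) x =
      ((normalClosure.algHomEquiv F L Ω).symm x).fieldRange.fixingSubgroup := by
  ext σ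
  rw [MulAction.mem_stabilizer_iff, IntermediateField.mem_fixingSubgroup_iff]
  change normalClosure.algHomEquiv F L Ω _ = x ↔ _
  rw [← Equiv.eq_symm_apply]
  constructor
  · rintro h _ ⟨z, rfl⟩
    exact congr($h z)
  · intro h
    ext1 z
    exact h _ ⟨z, rfl⟩

/-- If a in A moves x to gx, then a⁻¹g fixes x. This is the only way transitivity of A enters. -/
lemma mul_stabilizer_eq_univ {G X : Type*} [Group G] [MulAction G X] (x : X) (A : Subgroup G)
    [MulAction.IsPretransitive A X] :
    (A : Set G) * (MulAction.stabilizer G x : Set G) = Set.univ := by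
  refine Set.eq_univ_of_forall fun g => ?_
  obtain ⟨a, ha⟩ := MulAction.exists_smul_eq A x (g • x)
  refine ⟨a, a.2, (a : G)⁻¹ * g, ?_, mul_inv_cancel_left _ _⟩
  change ((a : G)⁻¹ * g) • x = x
  rw [mul_smul, ← ha, Subgroup.smul_def, inv_smul_smul]

end Monodromy

end CurveCovers

/-! ### Assembling the bijections -/

open CurveCovers in
theorem lemma2p1 {K : Type u} [Field K] {C D : Curve K} (φ : C ⟶ D) [IsCover φ]
    (Ω : Type v) [Field Ω] [Algebra D.functionField Ω] [IsAlgClosure D.functionField Ω]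
    (x : Embedding φ Ω) (H : Subgroup (Mon φ Ω)) (hH : H = MulAction.stabilizer (Mon φ Ω) x)
    (A : Subgroup (Mon φ Ω)) (hA : MulAction.IsPretransitive A (Embedding φ Ω)) :
    ∃ (e₂ : DecompositionClass φ ≃
        IncreasingChain (⊥ : IntermediateField D.functionField (SourceField φ)) ⊤)
      (e₃ : DecompositionClass φ ≃ DecreasingChain (⊤ : Subgroup (Mon φ Ω)) H)
      (e₄ : DecompositionClass φ ≃ PermutableChain A H),
      ∀ d : Decomposition φ,
        (e₂ d.toClass).fieldDegrees = d.1.degrees.reverse ∧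
        (e₃ d.toClass).indices = d.1.degrees.reverse ∧
        (e₄ d.toClass).1.indices = d.1.degrees.reverse := by
  have hsep : Algebra.IsSeparable D.functionField (SourceField φ) := IsCover.separable
  have hnormal : Normal D.functionField Ω := IsAlgClosure.normal D.functionField Ω
  have hgal : IsGalois D.functionField
      (IntermediateField.normalClosure D.functionField (SourceField φ) Ω) := by
    -- The normal closure is the compositum of the images of K(C) in Ω, each isomorphic to K(C) and
    -- therefore separable over K(D).
    have : Algebra.IsSeparable D.functionField
        (IntermediateField.normalClosure D.functionField (SourceField φ) Ω) := by
      have h (f : SourceField φ →ₐ[D.functionField] Ω) :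
          Algebra.IsSeparable D.functionField f.fieldRange :=
        .of_algHom _ _ (AlgEquiv.ofInjectiveField f).symm.toAlgHom
      rw [normalClosure_def]
      infer_instance
    exact ⟨⟩
  obtain ⟨e₂, he₂⟩ := exists_equiv_intermediateFieldChain φ
  obtain ⟨e, he⟩ := exists_equiv_subgroupChain
    ((normalClosure.algHomEquiv D.functionField (SourceField φ) Ω).symm x)
    (hH.trans (stabilizer_eq_fixingSubgroup x))
  obtain ⟨e', he'⟩ := exists_equiv_permutableChain (A := A) (H := H)
    (hH ▸ mul_stabilizer_eq_univ x A)
  refine ⟨e₂, e₂.trans e, (e₂.trans e).trans e', fun d => ⟨he₂ d, ?_, ?_⟩⟩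
  · exact (he _).trans (he₂ d)
  · exact (he' _).trans ((he _).trans (he₂ d))
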